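/- \textbf{Maps.} A map is a finite non-empty graph embedded in a compact connected oriented surface without boundary so that all faces are simply connected, up to orientation-preserving homeomorphism. Equivalently, it is a triple $(\sigma,\alpha,\varphi)$ of permutations of the finite non-empty set $E$ of half-edges (oriented edges) with $\varphi\alpha\sigma=1$, $\alpha$ a fixed-point-free involution and $\langle\sigma,\alpha,\varphi\rangle$ transitive on $E$, up to isomorphism. Here $\sigma$ turns counterclockwise around the origin $e^-$ of a half-edge $e$, $\alpha(e)=\bar e$ is its reversal, with $e^+=\bar e^-$, and $\varphi$ follows counterclockwise the boundary of the face to the left of $e$. Vertices, edges and faces are the cycles of $\sigma,\alpha,\varphi$, and the genus $g$ is given by $|V|-|\mathbf E|+|F|=2-2g$. The corner of $e$ is the angular sector from $e$ counterclockwise to $\sigma(e)$; it lies in the face of $e$. A map is rooted if a half-edge $e_*$ (equivalently, a corner) is distinguished. Let $g\ge 0$ and $k\ge 1$. \textbf{Quadrangulations with delays.} Let $\mathbf Q_{g,k}$ be the set of triples $(\mathbf q,\mathbf x,D)$, up to isomorphism, where $\mathbf q$ is a rooted bipartite quadrangulation of genus $g$ (all faces of degree $4$), $\mathbf x=(x_1,\dots,x_k)$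 are vertices of $\mathbf q$, and $D=[d_1,\dots,d_k]$ is the class of a vector of $\mathbb Z^k$ modulo addition of a common integer, such that $|d_i-d_j|<d_{\mathbf q}(x_i,x_j)$ for $i\ne j$ and $d_{\mathbf q}(x_i,x_j)+d_i-d_j\in 2\mathbb Z_{\ge 0}$ for all $i,j$, with $d_{\mathbf q}$ the graph distance. \textbf{Labeled maps.} Let $\mathbf{LM}_{g,k}$ be the set of pairs $(\mathbf m,[\ell])$, up to isomorphism, where $\mathbf m$ is a rooted map of genus $g$ with $k$ faces indexed $f_1,\dots,f_k$, and $[\ell]$ is the class, modulo addition of a constant integer, of a function $\ell:V(\mathbf m)\to\mathbb Z$ with $|\ell(x)-\ell(y)|\le 1$ for all adjacent $x,y$. \textbf{The mapping.} Given $(\mathbf q,\mathbf x,D)\in\mathbf Q_{g,k}$, label the vertices of $\mathbf q$ by $\ell(x)=\min_i(d_i+d_{\mathbf q}(x,x_i))$. The labels around a face, read counterclockwise from a vertex with lowest label, are $l,l+1,l+2,l+1$ (simple face) or $l,l+1,l,l+1$ (confluent face). Inside each face add one edge: in a simple face it joins the corner with highest label to the next corner in clockwise order around the face, and in a confluent face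 it joins the two corners with highest label. The added edges form a map $\mathbf m$ of genus $g$ with vertex set $V(\mathbf q)\setminus\{x_1,\dots,x_k\}$, labeled by the restriction of $\ell$, and with $k$ faces, each of which contains exactly one of the $x_i$; the face that contains $x_i$ is $f_i$. For a corner $h$ of $\mathbf m$ lying in $f_i$, with $\ell(h)$ the label of its vertex, the successor $s(h)$ is $x_i$ if $\ell(h)$ is the minimal label of a corner of $f_i$, and otherwise it is the first corner $\varphi^n(h)$, $n\ge 1$, with $\ell(\varphi^n(h))=\ell(h)-1$. There is a unique corner $h$ of $\mathbf m$ such that the root edge $e_*$ of $\mathbf q$, or its reversal $\bar e_*$, is the edge that starts inside the corner $h$ and ends at $s(h)$ (inside the corner $s(h)$ if this is a corner). Root $\mathbf m$ at $h$, and set $\Psi_{g,k}(\mathbf q,\mathbf x,D)=(\mathbf m,[\ell])$. \textbf{Corollary.} The mapping $\Psi_{g,k}:\mathbf Q_{g,k}\to\mathbf{LM}_{g,k}$ is well defined and two-to-one: every element of $\mathbf{LM}_{g,k}$ has exactly two preimages. -/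

import Mathlib

/-- A map (finite graph cellularly embedded in a compact connected oriented surface), up to
orientation-preserving homeomorphism, given by its fatgraph structure: `E` is the non-empty finite
set of half-edges, `σ` turns counterclockwise around the origin of a half-edge, `α` reverses
half-edges, and `φ` moves counterclockwise along the boundary of the face lying to the left of a
half-edge. -/
structure Fatgraph where
  E : Type
  finite : Finite E
  nonempty : Nonempty E
  σ : Equiv.Perm E
  α : Equiv.Perm E
  φ : Equiv.Perm E
  φ_α_σ : φ * α * σ = 1
  α_invol : ∀ e, α (α e) = e
  α_ne : ∀ e, α e ≠ e
  transitive : ∀ e e' : E, ∃ π ∈ Subgroup.closure ({σ, α, φ} : Set (Equiv.Perm E)), π e = e'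

namespace Fatgraph

variable (m : Fatgraph)

/-- Vertices are the cycles of `σ`. -/
def Vertex : Type := Quotient (Equiv.Perm.SameCycle.setoid m.σ)

/-- Edges are the cycles of `α`. -/
def Edge : Type := Quotient (Equiv.Perm.SameCycle.setoid m.α)

/-- Faces are the cycles of `φ`. -/
def Face : Type := Quotient (Equiv.Perm.SameCycle.setoid m.φ)

/-- The origin `e⁻` of a half-edge. -/
def src (e : m.E) : m.Vertex := Quotient.mk _ e

/-- The end point `e⁺` of a half-edge. -/
def tgt (e : m.E) : m.Vertex := m.src (m.α e)

/-- The face incident to (lying to the left of) a half-edge. -/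
def face (e : m.E) : m.Face := Quotient.mk _ e

/-- The map has genus `g`, by Euler's formula. -/
def HasGenus (g : ℕ) : Prop :=
  (Nat.card m.Vertex : ℤ) - Nat.card m.Edge + Nat.card m.Face = 2 - 2 * (g : ℤ)

/-- All faces have degree four. -/
def IsQuadrangulation : Prop :=
  ∀ f : m.Face, Nat.card {e : m.E // m.face e = f} = 4

def IsBipartite : Prop :=
  ∃ c : m.Vertex → Bool, ∀ e : m.E, c (m.src e) ≠ c (m.tgt e)

/-- The simple graph that underlies the map, used only for the graph distance. -/
def graph : SimpleGraph m.Vertex :=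
  SimpleGraph.fromRel fun x y => ∃ e : m.E, m.src e = x ∧ m.tgt e = y

/-- The graph distance between vertices. -/
noncomputable def dist (x y : m.Vertex) : ℕ := m.graph.dist x y

/-- An isomorphism of maps. -/
structure Iso (m m' : Fatgraph) where
  toEquiv : m.E ≃ m'.E
  map_σ : ∀ e, toEquiv (m.σ e) = m'.σ (toEquiv e)
  map_α : ∀ e, toEquiv (m.α e) = m'.α (toEquiv e)
  map_φ : ∀ e, toEquiv (m.φ e) = m'.φ (toEquiv e)

end Fatgraph

/-! ### Quadrangulations with sources and delays -/

/-- A bipartite quadrangulation of genus `g` with `k` sources `x` and a representative `d` of a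
delay vector. -/
structure DelayedQuad (g k : ℕ) extends Fatgraph where
  genus : toFatgraph.HasGenus g
  quad : toFatgraph.IsQuadrangulation
  bip : toFatgraph.IsBipartite
  x : Fin k → toFatgraph.Vertex
  d : Fin k → ℤ
  delay_lt : ∀ i j, i ≠ j → |d i - d j| < (toFatgraph.dist (x i) (x j) : ℤ)
  delay_even : ∀ i j, ∃ n : ℕ, (toFatgraph.dist (x i) (x j) : ℤ) + d i - d j = 2 * (n : ℤ)

/-- A rooted such quadrangulation. -/
structure RootedDelayedQuad (g k : ℕ) extends DelayedQuad g k where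
  root : E

/-- Isomorphism of maps that respects root and sources, the delays being considered up to a common
additive constant. -/
def RootedDelayedQuad.Equivalent {g k : ℕ} (Q Q' : RootedDelayedQuad g k) : Prop :=
  ∃ f : Fatgraph.Iso Q.toFatgraph Q'.toFatgraph,
    f.toEquiv Q.root = Q'.root ∧
    (∀ e i, Q.src e = Q.x i ↔ Q'.src (f.toEquiv e) = Q'.x i) ∧
    ∃ c : ℤ, ∀ i, Q'.d i = Q.d i + c

/-! ### Labeled maps -/

/-- A map of genus `g` with `k` indexed faces and a representative `lab` of a class of labelings. -/
structure LabeledMap (g k : ℕ) extends Fatgraph where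
  genus : toFatgraph.HasGenus g
  idx : toFatgraph.Face ≃ Fin k
  lab : toFatgraph.Vertex → ℤ
  lab_adj : ∀ e, |lab (toFatgraph.src e) - lab (toFatgraph.tgt e)| ≤ 1

/-- A rooted labeled map. -/
structure RootedLabeledMap (g k : ℕ) extends LabeledMap g k where
  root : E

/-- Isomorphism of maps that respects root and indices of faces, the labels being considered up to
a common additive constant. -/
def RootedLabeledMap.Equivalent {g k : ℕ} (M M' : RootedLabeledMap g k) : Prop :=
  ∃ f : Fatgraph.Iso M.toFatgraph M'.toFatgraph,
    f.toEquiv M.root = M'.root ∧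
    (∀ e, M'.idx (M'.face (f.toEquiv e)) = M.idx (M.face e)) ∧
    ∃ c : ℤ, ∀ e, M'.lab (M'.src (f.toEquiv e)) = M.lab (M.src e) + c

namespace Fatgraph

def Iso.refl (m : Fatgraph) : Iso m m :=
  ⟨Equiv.refl _, fun _ => rfl, fun _ => rfl, fun _ => rfl⟩

def Iso.symm {m m' : Fatgraph} (f : Iso m m') : Iso m' m where
  toEquiv := f.toEquiv.symm
  map_σ e := by rw [Equiv.symm_apply_eq, f.map_σ, Equiv.apply_symm_apply]
  map_α e := by rw [Equiv.symm_apply_eq, f.map_α, Equiv.apply_symm_apply]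
  map_φ e := by rw [Equiv.symm_apply_eq, f.map_φ, Equiv.apply_symm_apply]

def Iso.trans {m m' m'' : Fatgraph} (f : Iso m m') (f' : Iso m' m'') : Iso m m'' where
  toEquiv := f.toEquiv.trans f'.toEquiv
  map_σ e := by simp [f.map_σ, f'.map_σ]
  map_α e := by simp [f.map_α, f'.map_α]
  map_φ e := by simp [f.map_φ, f'.map_φ]

end Fatgraph

instance RootedDelayedQuad.setoid (g k : ℕ) : Setoid (RootedDelayedQuad g k) where
  r := RootedDelayedQuad.Equivalent
  iseqv :=
    { refl := fun Q => ⟨Fatgraph.Iso.refl _, rfl, fun _ _ => Iff.rfl, 0, fun _ => by simp⟩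
      symm := by
        rintro Q Q' ⟨f, hr, hx, c, hc⟩
        refine ⟨f.symm, ?_, fun e i => ?_, -c, fun i => by rw [hc]; ring⟩
        · simp [Fatgraph.Iso.symm, ← hr]
        · rw [hx]; simp [Fatgraph.Iso.symm]
      trans := by
        rintro Q Q' Q'' ⟨f, hr, hx, c, hc⟩ ⟨f', hr', hx', c', hc'⟩
        refine ⟨f.trans f', ?_, fun e i => ?_, c + c', fun i => by rw [hc', hc]; ring⟩
        · simp [Fatgraph.Iso.trans, hr, hr']
        · rw [hx, hx']; simp [Fatgraph.Iso.trans] }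

instance RootedLabeledMap.setoid (g k : ℕ) : Setoid (RootedLabeledMap g k) where
  r := RootedLabeledMap.Equivalent
  iseqv :=
    { refl := fun M => ⟨Fatgraph.Iso.refl _, rfl, fun _ => rfl, 0, fun _ => by
        simp [Fatgraph.Iso.refl]⟩
      symm := by
        rintro M M' ⟨f, hr, hi, c, hc⟩
        refine ⟨f.symm, ?_, fun e => ?_, -c, fun e => ?_⟩
        · simp [Fatgraph.Iso.symm, ← hr]
        · rw [← hi]; simp [Fatgraph.Iso.symm]
        · have h := hc (f.symm.toEquiv e)
          have h' : f.toEquiv (f.symm.toEquiv e) = e := by simp [Fatgraph.Iso.symm]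
          rw [h'] at h
          rw [h]; ring
      trans := by
        rintro M M' M'' ⟨f, hr, hi, c, hc⟩ ⟨f', hr', hi', c', hc'⟩
        refine ⟨f.trans f', ?_, fun e => ?_, c + c', fun e => ?_⟩
        · simp [Fatgraph.Iso.trans, hr, hr']
        · rw [← hi, ← hi']; simp [Fatgraph.Iso.trans]
        · have h := hc' (f.toEquiv e)
          rw [hc] at h
          simpa [Fatgraph.Iso.trans, add_assoc] using h }

/-- The set of rooted bipartite quadrangulations of genus `g` with `k` sources and delays. -/
def QClass (g k : ℕ) : Type 1 := Quotient (RootedDelayedQuad.setoid g k)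

/-- The set of rooted labeled maps of genus `g` with `k` indexed faces. -/
def LMClass (g k : ℕ) : Type 1 := Quotient (RootedLabeledMap.setoid g k)

/-! ### The edges added to a quadrangulation -/

namespace DelayedQuad

variable {g k : ℕ} (Q : DelayedQuad g k)

/-- The label `min_i (d_i + dist (v, x_i))` of a vertex. -/
noncomputable def label (v : Q.Vertex) : ℤ :=
  ⨅ i : Fin k, (Q.d i + (Q.dist v (Q.x i) : ℤ))

/-- The label of (the origin of) a half-edge or corner. -/
noncomputable def elabel (e : Q.E) : ℤ := Q.label (Q.src e)

/-- The face of `b`, read counterclockwise from `b`, has labels `l, l+1, l+2, l+1`. -/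
def SimpleAt (b : Q.E) : Prop :=
  Q.elabel (Q.φ b) = Q.elabel b + 1 ∧
  Q.elabel (Q.φ (Q.φ b)) = Q.elabel b + 2 ∧
  Q.elabel (Q.φ (Q.φ (Q.φ b))) = Q.elabel b + 1

/-- The face of `b`, read counterclockwise from `b`, has labels `l, l+1, l, l+1`. -/
def ConfluentAt (b : Q.E) : Prop :=
  Q.elabel (Q.φ b) = Q.elabel b + 1 ∧
  Q.elabel (Q.φ (Q.φ b)) = Q.elabel b ∧
  Q.elabel (Q.φ (Q.φ (Q.φ b))) = Q.elabel b + 1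

/-- An edge is added between the corners `c` and `c'` of one face (the corner of the half-edge `c`
is the angular sector from `c` counterclockwise to `σ c`): in a simple face, between the corner with
highest label and the next one clockwise around the face; in a confluent face, between the two
corners with highest label. -/
def Added (c c' : Q.E) : Prop :=
  ∃ b : Q.E,
    (Q.SimpleAt b ∧
      ((c = Q.φ (Q.φ b) ∧ c' = Q.φ b) ∨ (c = Q.φ b ∧ c' = Q.φ (Q.φ b)))) ∨
    (Q.ConfluentAt b ∧ c = Q.φ b ∧ c' = Q.φ (Q.φ (Q.φ b)))

end DelayedQuad

/-! ### Successors in a labeled map -/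

namespace LabeledMap

variable {g k : ℕ} (M : LabeledMap g k)

/-- The label of (the origin of) a half-edge or corner. -/
def elabel (h : M.E) : ℤ := M.lab (M.src h)

/-- The label given to the vertex that the converse construction puts into the `i`-th face. -/
noncomputable def sourceLabel (i : Fin k) : ℤ :=
  (⨅ h : {h : M.E // M.idx (M.face h) = i}, M.elabel h.1) - 1

open Classical in
/-- The successor of a corner: the new vertex of its face (`Sum.inr`) if the corner has the least
label in its face, and otherwise the first corner along the face with a label smaller by one. -/
noncomputable def succ (h : M.E) : M.E ⊕ Fin k :=
  if M.elabel h = M.sourceLabel (M.idx (M.face h)) + 1 then Sum.inr (M.idx (M.face h))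
  else Sum.inl ((M.φ ^ sInf {n : ℕ | 1 ≤ n ∧ M.elabel ((M.φ ^ n) h) = M.elabel h - 1}) h)

end LabeledMap

/-! ### The correspondence -/

section Overlay

variable {g k : ℕ} (Q : DelayedQuad g k) (M : LabeledMap g k) (β : M.E → Q.E)

/-- When each half-edge `h` of `M` starts inside the corner `β h` of `Q`, the half-edge `e` of `Q`
starts inside the corner of `M` between `h` and `M.σ h`. -/
def InCorner (h : M.E) (e : Q.E) : Prop :=
  ∃ n : ℕ, 1 ≤ n ∧ e = (Q.σ ^ n) (β h) ∧ ∀ j, 1 ≤ j → j < n → (Q.σ ^ j) (β h) ∉ Set.range β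

/-- `M` is the unrooted labeled map made of the edges added to `Q`, the half-edge `h` of `M` being
drawn so that it starts inside the corner `β h` of `Q`. -/
structure IsOverlay : Prop where
  inj : Function.Injective β
  /-- The edges of `M` are the added ones. -/
  edges : ∀ c c', (∃ h, β h = c ∧ β (M.α h) = c') ↔ Q.Added c c'
  /-- `M.σ` is the counterclockwise order of the added half-edges around a vertex. -/
  next : ∀ h, InCorner Q M β h (β (M.σ h))
  /-- The labels are those of `Q`, up to an additive constant. -/
  labels : ∃ a : ℤ, ∀ h, M.elabel h = Q.elabel (β h) + a
  /-- The `i`-th face of `M` is the one that contains `x i`: an edge of `Q` crosses no edge of `M`,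
  so one that ends at `x i` lies in the face of `M` in whose corner it starts. -/
  faces : ∀ h e i, InCorner Q M β h e → Q.tgt e = Q.x i → M.idx (M.face h) = i

/-- The half-edge `e` of `Q` is the one drawn from the corner `h` of `M` to the successor of `h`. -/
def IsDrawn (h : M.E) (e : Q.E) : Prop :=
  InCorner Q M β h e ∧
    match M.succ h with
    | Sum.inl h' => InCorner Q M β h' (Q.α e)
    | Sum.inr i => Q.tgt e = Q.x i

end Overlay

/-- The rooted labeled map `M` is obtained from `Q` by the construction, its root being the
corner `h` such that the edge drawn from `h` to its successor is the root edge of `Q` or its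
reversal. -/
def IsPsiRep {g k : ℕ} (Q : RootedDelayedQuad g k) (M : RootedLabeledMap g k) : Prop :=
  ∃ β : M.E → Q.E, IsOverlay Q.toDelayedQuad M.toLabeledMap β ∧
    (IsDrawn Q.toDelayedQuad M.toLabeledMap β M.root Q.root ∨
      IsDrawn Q.toDelayedQuad M.toLabeledMap β M.root (Q.α Q.root))

/-- The graph of the correspondence on isomorphism classes. -/
def IsPsi {g k : ℕ} (Q : QClass g k) (M : LMClass g k) : Prop :=
  ∃ (q : RootedDelayedQuad g k) (m : RootedLabeledMap g k),
    Quotient.mk _ q = Q ∧ Quotient.mk _ m = M ∧ IsPsiRep q m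

/-! ### Rotation systems and successors -/

theorem Equiv.Perm.SameCycle.exists_iterate_eq {X : Type*} [Finite X] {f : Equiv.Perm X} {x y : X}
    (h : f.SameCycle x y) : ∃ n : ℕ, f^[n] x = y :=
  h.exists_nat_pow_eq

theorem Equiv.Perm.sameCycle_iterate {X : Type*} (f : Equiv.Perm X) (n : ℕ) (x : X) :
    f.SameCycle x (f^[n] x) :=
  ⟨n, rfl⟩

/-- A map that need not be connected. -/
structure RotationSystem (E : Type) where
  σ : Equiv.Perm E
  α : Equiv.Perm E
  φ : Equiv.Perm E
  φ_α_σ : ∀ e, φ (α (σ e)) = e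
  α_invol : ∀ e, α (α e) = e

namespace RotationSystem

variable {E : Type} (m : RotationSystem E)

theorem σ_φ (e : E) : m.σ (m.φ e) = m.α e := by
  have h := m.φ.injective (m.φ_α_σ (m.φ e))
  rw [← m.α_invol (m.σ (m.φ e)), h]

theorem φ_α (e : E) : m.σ (m.φ (m.α e)) = e := by
  rw [m.σ_φ, m.α_invol]

end RotationSystem

/-- A possibly disconnected map with labels that vary by at most one along an edge. -/
structure LabeledRotation (H : Type) extends RotationSystem H where
  lab : H → ℤ
  lab_σ : ∀ h, lab (σ h) = lab h
  lab_α : ∀ h, |lab (α h) - lab h| ≤ 1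

namespace LabeledRotation

variable {H : Type} (M : LabeledRotation H)

theorem lab_φ (h : H) : M.lab (M.φ h) = M.lab (M.α h) := by
  rw [← M.lab_σ, M.σ_φ]

theorem lab_eq_of_sameCycle [Finite H] {h h' : H} (hs : M.σ.SameCycle h h') :
    M.lab h' = M.lab h := by
  obtain ⟨n, rfl⟩ := hs.exists_iterate_eq
  clear hs
  induction n with
  | zero => rfl
  | succ n ih => rw [Function.iterate_succ_apply', M.lab_σ, ih]

theorem lab_φ_cases (h : H) : M.lab (M.φ h) = M.lab h - 1 ∨ M.lab (M.φ h) = M.lab h ∨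
    M.lab (M.φ h) = M.lab h + 1 := by
  have h1 := abs_le.1 (M.lab_α h)
  rw [M.lab_φ]
  omega

/-- The corner `g` is the first one after `h` with a smaller label, and is reached after `n + 1`
steps. -/
def SuccAt (n : ℕ) (h g : H) : Prop :=
  M.φ^[n + 1] h = g ∧ M.lab g = M.lab h - 1 ∧ ∀ j ≤ n, M.lab h ≤ M.lab (M.φ^[j] h)

/-- The corner `g` is the first one after `h` with a smaller label. -/
def IsSucc (h g : H) : Prop := ∃ n, M.SuccAt n h g

/-- No corner of the face of `h` has a smaller label than `h`. -/
def IsMin (h : H) : Prop := ∀ n, M.lab h ≤ M.lab (M.φ^[n] h)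

variable {M}

theorem isMin_or_exists_isSucc (h : H) : M.IsMin h ∨ ∃ g, M.IsSucc h g := by
  classical
  by_cases hm : M.IsMin h
  · exact Or.inl hm
  right
  have hex : ∃ n, M.lab (M.φ^[n] h) < M.lab h := by
    simpa [IsMin] using hm
  obtain ⟨n, hn⟩ : ∃ n, Nat.find hex = n + 1 := by
    refine Nat.exists_eq_succ_of_ne_zero fun h0 => ?_
    have := Nat.find_spec hex
    rw [h0] at this
    exact lt_irrefl _ this
  have hlt := Nat.find_spec hex
  have hle : ∀ j ≤ n, M.lab h ≤ M.lab (M.φ^[j] h) := fun j hj => by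
    have := Nat.find_min hex (m := j) (by omega)
    omega
  rw [hn] at hlt
  refine ⟨M.φ^[n + 1] h, n, rfl, ?_, hle⟩
  have h1 := hle n le_rfl
  have h2 := M.lab_φ_cases (M.φ^[n] h)
  rw [← Function.iterate_succ_apply' M.φ n h] at h2
  change M.lab (M.φ^[n + 1] h) = _ ∨ M.lab (M.φ^[n + 1] h) = _ ∨ M.lab (M.φ^[n + 1] h) = _ at h2
  omega

theorem SuccAt.le {n n' : ℕ} {h g g' : H} (hg : M.SuccAt n h g) (hg' : M.SuccAt n' h g') :
    n ≤ n' := by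
  by_contra hlt
  have h1 := hg.2.2 (n' + 1) (by omega)
  rw [hg'.1, hg'.2.1] at h1
  omega

theorem IsSucc.unique {h g g' : H} (hg : M.IsSucc h g) (hg' : M.IsSucc h g') : g = g' := by
  obtain ⟨n, hn⟩ := hg
  obtain ⟨n', hn'⟩ := hg'
  obtain rfl : n = n' := le_antisymm (hn.le hn') (hn'.le hn)
  exact hn.1.symm.trans hn'.1

theorem IsSucc.lab_eq {h g : H} (hg : M.IsSucc h g) : M.lab g = M.lab h - 1 := by
  obtain ⟨n, hn⟩ := hg
  exact hn.2.1

theorem IsSucc.sameCycle {h g : H} (hg : M.IsSucc h g) : M.φ.SameCycle h g := by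
  obtain ⟨n, hn⟩ := hg
  exact hn.1 ▸ Equiv.Perm.sameCycle_iterate _ _ _

theorem IsSucc.not_isMin {h g : H} (hg : M.IsSucc h g) : ¬ M.IsMin h := by
  obtain ⟨n, hn⟩ := hg
  intro hm
  have := hm (n + 1)
  rw [hn.1, hn.2.1] at this
  omega

theorem IsMin.le [Finite H] {h g : H} (hm : M.IsMin h) (hg : M.φ.SameCycle h g) :
    M.lab h ≤ M.lab g := by
  obtain ⟨n, rfl⟩ := hg.exists_iterate_eq
  exact hm n

theorem isMin_iff [Finite H] {h : H} :
    M.IsMin h ↔ ∀ g, M.φ.SameCycle h g → M.lab h ≤ M.lab g :=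
  ⟨fun hm _ hg => hm.le hg, fun hm _ => hm _ (Equiv.Perm.sameCycle_iterate _ _ _)⟩

theorem IsMin.of_sameCycle [Finite H] {h g : H} (hm : M.IsMin h) (hg : M.φ.SameCycle h g)
    (hl : M.lab g = M.lab h) : M.IsMin g :=
  isMin_iff.2 fun _ hg' => hl ▸ hm.le (hg.trans hg')

/-- Every face has a corner with minimal label. -/
theorem exists_isMin [Finite H] (h : H) : ∃ g, M.φ.SameCycle h g ∧ M.IsMin g := by
  have : Finite {g // M.φ.SameCycle h g} := inferInstance
  have : Nonempty {g // M.φ.SameCycle h g} := ⟨⟨h, .rfl⟩⟩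
  obtain ⟨⟨g, hg⟩, hmin⟩ := Finite.exists_min fun g : {g // M.φ.SameCycle h g} => M.lab g
  exact ⟨g, hg, isMin_iff.2 fun g' hg' => hmin ⟨g', hg.trans hg'⟩⟩

theorem exists_isSucc_of_sameCycle [Finite H] {h g : H} (hg : M.φ.SameCycle h g)
    (hl : M.lab g < M.lab h) : ∃ g', M.IsSucc h g' :=
  (isMin_or_exists_isSucc h).resolve_left fun hm => absurd (hm.le hg) (by omega)

theorem isSucc_φ {h : H} (hh : M.lab (M.φ h) = M.lab h - 1) : M.IsSucc h (M.φ h) :=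
  ⟨0, rfl, hh, fun j hj => by obtain rfl : j = 0 := by omega
                              exact le_rfl⟩

theorem SuccAt.cons {n : ℕ} {h g : H} (hh : M.lab (M.φ h) = M.lab h)
    (hg : M.SuccAt n (M.φ h) g) : M.SuccAt (n + 1) h g := by
  obtain ⟨h1, h2, h3⟩ := hg
  refine ⟨h1, by omega, fun j hj => ?_⟩
  rcases j with _ | j
  · exact le_rfl
  · exact hh ▸ h3 j (by omega)

theorem SuccAt.append {n n' : ℕ} {h g g' : H} (hh : M.lab (M.φ h) = M.lab h + 1)
    (hg : M.SuccAt n (M.φ h) g) (hg' : M.SuccAt n' g g') : M.SuccAt (n + n' + 2) h g' := by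
  obtain ⟨h1, h2, h3⟩ := hg
  obtain ⟨h1', h2', h3'⟩ := hg'
  have key : ∀ j, M.φ^[j + (n + 2)] h = M.φ^[j] g := fun j => by
    rw [Function.iterate_add_apply, ← h1]; rfl
  refine ⟨?_, by omega, fun j hj => ?_⟩
  · rw [show n + n' + 2 + 1 = (n' + 1) + (n + 2) by ring, key, h1']
  · rcases Nat.lt_or_ge j (n + 2) with hj' | hj'
    · rcases j with _ | j
      · exact le_rfl
      · have := h3 j (by omega)
        change M.lab h ≤ M.lab (M.φ^[j] (M.φ h))
        omega
    · obtain ⟨i, rfl⟩ := Nat.exists_eq_add_of_le' hj'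
      rw [key]
      have := h3' i (by omega)
      omega

theorem SuccAt.decompose {n : ℕ} {h g : H} (hg : M.SuccAt n h g) :
    (M.lab (M.φ h) = M.lab h - 1 ∧ g = M.φ h) ∨
    (M.lab (M.φ h) = M.lab h ∧ ∃ n' < n, M.SuccAt n' (M.φ h) g) ∨
    (M.lab (M.φ h) = M.lab h + 1 ∧ ∃ g', (∃ n' < n, M.SuccAt n' (M.φ h) g') ∧
      ∃ n' < n, M.SuccAt n' g' g) := by
  obtain ⟨h1, h2, h3⟩ := id hg
  rcases M.lab_φ_cases h with hh | hh | hh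
  · exact Or.inl ⟨hh, IsSucc.unique ⟨n, hg⟩ (isSucc_φ hh)⟩
  · right; left
    refine ⟨hh, ?_⟩
    rcases n with _ | n
    · change M.φ h = g at h1
      rw [h1] at hh
      omega
    · exact ⟨n, by omega, h1, by omega, fun j hj => hh ▸ h3 (j + 1) (by omega)⟩
  · right; right
    refine ⟨hh, ?_⟩
    have hnm : ¬ M.IsMin (M.φ h) := fun hm => by
      have : M.lab (M.φ h) ≤ M.lab (M.φ^[n + 1] h) := hm n
      rw [h1] at this
      omega
    obtain ⟨g', n', hg'⟩ := (isMin_or_exists_isSucc (M.φ h)).resolve_left hnm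
    obtain ⟨h1', h2', h3'⟩ := id hg'
    have hlt : n' < n := by
      by_contra hle
      have := h3' n (by omega)
      change M.lab (M.φ h) ≤ M.lab (M.φ^[n + 1] h) at this
      rw [h1] at this
      omega
    have hne : n' + 1 ≠ n := by
      rintro rfl
      have : M.φ^[n' + 1 + 1] h = g' := h1'
      rw [h1] at this
      subst this
      omega
    obtain ⟨r, rfl⟩ := Nat.exists_eq_add_of_le' (show n' + 2 ≤ n by omega)
    have key : ∀ j, M.φ^[j + (n' + 2)] h = M.φ^[j] g' := fun j => by
      rw [Function.iterate_add_apply, ← h1']; rfl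
    refine ⟨g', ⟨n', hlt, hg'⟩, r, by omega, ?_, by omega, fun j hj => ?_⟩
    · rw [← key, ← h1, show r + 1 + (n' + 2) = r + (n' + 2) + 1 by ring]
    · rw [← key]
      have := h3 (j + (n' + 2)) (by omega)
      omega

theorem IsSucc.induction {P : H → H → Prop}
    (down : ∀ h, M.lab (M.φ h) = M.lab h - 1 → P h (M.φ h))
    (flat : ∀ h g, M.lab (M.φ h) = M.lab h → P (M.φ h) g → P h g)
    (up : ∀ h g g', M.lab (M.φ h) = M.lab h + 1 → P (M.φ h) g → P g g' → P h g')
    {h g : H} (hg : M.IsSucc h g) : P h g := by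
  obtain ⟨n, hn⟩ := hg
  induction n using Nat.strong_induction_on generalizing h g with
  | _ n ih =>
    rcases hn.decompose with ⟨hh, rfl⟩ | ⟨hh, n', hlt, hn'⟩ |
      ⟨hh, g', ⟨n₁, hlt₁, hn₁⟩, n₂, hlt₂, hn₂⟩
    · exact down _ hh
    · exact flat _ _ hh (ih n' hlt hn')
    · exact up _ _ _ hh (ih n₁ hlt₁ hn₁) (ih n₂ hlt₂ hn₂)

theorem IsSucc.cons {h g : H} (hh : M.lab (M.φ h) = M.lab h) (hg : M.IsSucc (M.φ h) g) :
    M.IsSucc h g := by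
  obtain ⟨n, hn⟩ := hg
  exact ⟨_, hn.cons hh⟩

theorem IsSucc.append {h g g' : H} (hh : M.lab (M.φ h) = M.lab h + 1)
    (hg : M.IsSucc (M.φ h) g) (hg' : M.IsSucc g g') : M.IsSucc h g' := by
  obtain ⟨n, hn⟩ := hg
  obtain ⟨n', hn'⟩ := hg'
  exact ⟨_, hn.append hh hn'⟩

theorem exists_isSucc_φ [Finite H] {h : H} (hh : M.lab (M.φ h) = M.lab h + 1) :
    ∃ g, M.IsSucc (M.φ h) g :=
  exists_isSucc_of_sameCycle (Equiv.Perm.SameCycle.refl M.φ h).apply_left (by omega)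

/-- Two corners after which the labels go up, and from which the walks return to their initial
level at the same corner, are equal. -/
theorem eq_of_isSucc_φ {h h' g : H} (hh : M.lab (M.φ h) = M.lab h + 1)
    (hh' : M.lab (M.φ h') = M.lab h' + 1) (hg : M.IsSucc (M.φ h) g) (hg' : M.IsSucc (M.φ h') g) :
    h = h' := by
  obtain ⟨n, hn⟩ := hg
  obtain ⟨n', hn'⟩ := hg'
  wlog hle : n ≤ n' generalizing h h' n n'
  · exact (this hh' hh n' hn' n hn (by omega)).symm
  obtain ⟨r, rfl⟩ := Nat.exists_eq_add_of_le' hle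
  have h1 : M.φ^[n + 2] h = M.φ^[n + 2] (M.φ^[r] h') := by
    rw [← Function.iterate_add_apply, show n + 2 + r = r + n + 2 by ring]
    exact hn.1.trans hn'.1.symm
  have h2 : h = M.φ^[r] h' := (M.φ.injective.iterate _) h1
  have hl := hn.2.1
  have hl' := hn'.2.1
  rcases r with _ | r
  · exact h2
  · have h3 := hn'.2.2 r (by omega)
    rw [show M.φ^[r] (M.φ h') = h from h2.symm] at h3
    omega

end LabeledRotation

/-! ### Labeled quadrangulations and the maps drawn on them -/

/-- A possibly disconnected map, all of whose faces have degree four, with labels that vary by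
exactly one along each edge. -/
structure LabeledQuad (E : Type) extends RotationSystem E where
  lab : E → ℤ
  lab_σ : ∀ e, lab (σ e) = lab e
  lab_α : ∀ e, lab (α e) = lab e + 1 ∨ lab (α e) = lab e - 1
  φ_four : ∀ e, φ (φ (φ (φ e))) = e
  φ_two_ne : ∀ e, φ (φ e) ≠ e

namespace LabeledQuad

variable {E : Type} (Q : LabeledQuad E)

/-- The label decreases along `e`. -/
def Dec (e : E) : Prop := Q.lab (Q.α e) = Q.lab e - 1

theorem lab_φ (e : E) : Q.lab (Q.φ e) = Q.lab (Q.α e) := by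
  rw [← Q.lab_σ, Q.σ_φ]

theorem lab_φ_cases (e : E) : Q.lab (Q.φ e) = Q.lab e + 1 ∨ Q.lab (Q.φ e) = Q.lab e - 1 := by
  rw [Q.lab_φ]
  exact Q.lab_α e

theorem dec_iff (e : E) : Q.Dec e ↔ Q.lab (Q.φ e) = Q.lab e - 1 := by
  rw [Dec, Q.lab_φ]

theorem not_dec_iff (e : E) : ¬ Q.Dec e ↔ Q.lab (Q.φ e) = Q.lab e + 1 := by
  rw [Q.dec_iff]
  have := Q.lab_φ_cases e
  omega

theorem dec_α_iff (e : E) : Q.Dec (Q.α e) ↔ ¬ Q.Dec e := by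
  rw [Dec, Dec, Q.α_invol]
  have := Q.lab_α e
  omega

theorem lab_eq_of_sameCycle [Finite E] {e e' : E} (h : Q.σ.SameCycle e e') :
    Q.lab e' = Q.lab e := by
  obtain ⟨n, rfl⟩ := h.exists_iterate_eq
  induction n with
  | zero => rfl
  | succ n ih =>
    rw [Function.iterate_succ_apply', Q.lab_σ]
    exact ih (Equiv.Perm.sameCycle_iterate _ _ _)

end LabeledQuad

/-- The half-edge `h` of `M` is drawn immediately before the decreasing half-edge `ε h` of `Q`
around their common origin, and the edges of `M` join the two increasing half-edges of each face
of `Q`. -/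
structure IsDrawing {E H : Type} (Q : LabeledQuad E) (M : LabeledRotation H) (ε : H → E) :
    Prop where
  inj : Function.Injective ε
  dec_iff : ∀ e, Q.Dec e ↔ ∃ h, ε h = e
  lab : ∀ h, M.lab h = Q.lab (ε h)
  swap : ∀ h, Q.φ (Q.α (ε h)) = Q.α (ε (M.α h)) ∨ Q.φ (Q.φ (Q.α (ε h))) = Q.α (ε (M.α h)) ∨
    Q.φ (Q.φ (Q.φ (Q.α (ε h)))) = Q.α (ε (M.α h))
  next : ∀ h, ∃ n, Q.σ^[n + 1] (ε h) = ε (M.σ h) ∧ ∀ j < n, ¬ Q.Dec (Q.σ^[j + 1] (ε h))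

namespace IsDrawing

variable {E H : Type} {Q : LabeledQuad E} {M : LabeledRotation H} {ε : H → E}

theorem dec (D : IsDrawing Q M ε) (h : H) : Q.Dec (ε h) := (D.dec_iff _).2 ⟨h, rfl⟩

theorem not_dec (D : IsDrawing Q M ε) (h : H) : ¬ Q.Dec (Q.α (ε h)) := by
  rw [Q.dec_α_iff, not_not]
  exact D.dec h

theorem exists_of_not_dec (D : IsDrawing Q M ε) {e : E} (he : ¬ Q.Dec e) : ∃ h, Q.α (ε h) = e := by
  obtain ⟨h, hh⟩ := (D.dec_iff _).1 ((Q.dec_α_iff e).2 he)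
  exact ⟨h, by rw [hh, Q.α_invol]⟩

theorem ne (D : IsDrawing Q M ε) (h h' : H) : ε h ≠ Q.α (ε h') := fun hh => D.not_dec h'
    (hh ▸ D.dec h)

theorem lab_α (D : IsDrawing Q M ε) (h : H) : Q.lab (Q.α (ε h)) = M.lab h - 1 := by
  rw [D.dec h, D.lab]

theorem face_cases (D : IsDrawing Q M ε) (h : H) :
    (M.lab (M.α h) = M.lab h + 1 ∧ Q.φ (Q.α (ε h)) = Q.α (ε (M.α h))) ∨
    (M.lab (M.α h) = M.lab h ∧ Q.φ (Q.φ (Q.α (ε h))) = Q.α (ε (M.α h))) ∨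
    (M.lab (M.α h) = M.lab h - 1 ∧ Q.φ (Q.α (ε (M.α h))) = Q.α (ε h)) := by
  have h0 := D.lab_α h
  have h0' := D.lab_α (M.α h)
  have h1 := (Q.not_dec_iff _).1 (D.not_dec h)
  have h1' := (Q.not_dec_iff _).1 (D.not_dec (M.α h))
  have h2 := Q.lab_φ_cases (Q.φ (Q.α (ε h)))
  have h3 := Q.lab_φ_cases (Q.φ (Q.φ (Q.α (ε h))))
  have h4 := Q.lab_φ_cases (Q.φ (Q.φ (Q.φ (Q.α (ε h)))))
  have h5 := Q.φ_four (Q.α (ε h))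
  rw [h5] at h4
  rcases D.swap h with hs | hs | hs
  · left
    rw [hs] at h1
    exact ⟨by omega, hs⟩
  · right; left
    rw [← hs] at h0' h1'
    exact ⟨by omega, hs⟩
  · right; right
    rw [← hs] at h0' h1'
    rw [h5] at h1'
    exact ⟨by omega, by rw [← hs, h5]⟩

theorem φ_α_of_lab_eq_add_one (D : IsDrawing Q M ε) {h : H} (hh : M.lab (M.α h) = M.lab h + 1) :
    Q.φ (Q.α (ε h)) = Q.α (ε (M.α h)) := by
  rcases D.face_cases h with h1 | h1 | h1
  · exact h1.2
  all_goals omega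

theorem φ_φ_α_of_lab_eq (D : IsDrawing Q M ε) {h : H} (hh : M.lab (M.α h) = M.lab h) :
    Q.φ (Q.φ (Q.α (ε h))) = Q.α (ε (M.α h)) := by
  rcases D.face_cases h with h1 | h1 | h1
  · omega
  · exact h1.2
  · omega

theorem α_ne (D : IsDrawing Q M ε) (h : H) : M.α h ≠ h := fun hh => by
  have h1 := D.φ_φ_α_of_lab_eq (congrArg M.lab hh)
  rw [hh] at h1
  exact Q.φ_two_ne _ h1

theorem ε_φ_α_of_dec (D : IsDrawing Q M ε) {h : H} (hh : Q.Dec (Q.φ (Q.α (ε h)))) :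
    ε (M.φ (M.α h)) = Q.φ (Q.α (ε h)) := by
  obtain ⟨n, hn, hn'⟩ := D.next (M.φ (M.α h))
  have h1 : Q.σ (Q.φ (Q.α (ε h))) = ε h := Q.φ_α _
  rw [M.φ_α, Function.iterate_succ_apply', ← h1] at hn
  have h2 := Q.σ.injective hn
  rcases n with _ | n
  · exact h2
  · exact absurd (h2 ▸ hh) (hn' n (by omega))

theorem φ_α_of_lab_le (D : IsDrawing Q M ε) {h : H} (hh : M.lab (M.α h) ≤ M.lab h) :
    Q.φ (Q.α (ε h)) = ε (M.φ (M.α h)) := by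
  refine (D.ε_φ_α_of_dec ?_).symm
  by_contra hd
  have h0 := D.lab_α h
  have h0' := D.lab_α (M.α h)
  have h1 := (Q.not_dec_iff _).1 (D.not_dec h)
  have h1' := (Q.not_dec_iff _).1 (D.not_dec (M.α h))
  have h2 := (Q.not_dec_iff _).1 hd
  rcases D.face_cases h with hc | hc | hc
  · omega
  · rw [← hc.2] at h1' h0'
    omega
  · rw [hc.2] at h1'
    have h3 := Q.lab_φ_cases (Q.φ (Q.φ (Q.α (ε h))))
    have h5 := Q.φ_four (Q.α (ε (M.α h)))
    rw [hc.2] at h5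
    rw [h5] at h3
    omega

theorem φ_ε_φ_of_lab_eq (D : IsDrawing Q M ε) {h : H} (hh : M.lab (M.φ h) = M.lab h) :
    Q.φ (ε (M.φ h)) = Q.α (ε h) := by
  rw [M.lab_φ] at hh
  have h1 := D.φ_α_of_lab_le (h := M.α h) (by rw [M.α_invol]; omega)
  have h2 := D.φ_φ_α_of_lab_eq (h := M.α h) (by rw [M.α_invol]; omega)
  rw [M.α_invol] at h1 h2
  rw [← h1, h2]

theorem φ_α_ε_α_of_lab_eq_add_one (D : IsDrawing Q M ε) {h : H} (hh : M.lab (M.φ h) = M.lab h + 1) :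
    Q.φ (Q.α (ε (M.α h))) = ε (M.φ h) := by
  rw [M.lab_φ] at hh
  have h1 := D.φ_α_of_lab_le (h := M.α h) (by rw [M.α_invol]; omega)
  rwa [M.α_invol] at h1

theorem φ_φ_ε_φ_of_lab_eq_add_one (D : IsDrawing Q M ε) {h : H} (hh : M.lab (M.φ h) = M.lab h + 1) :
    Q.φ (Q.φ (ε (M.φ h))) = Q.α (ε h) := by
  rw [← D.φ_α_ε_α_of_lab_eq_add_one hh, ← D.φ_α_of_lab_eq_add_one (M.lab_φ h ▸ hh), Q.φ_four]

theorem dec_φ_ε_φ_of_lab_eq_add_one (D : IsDrawing Q M ε) {h : H}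
    (hh : M.lab (M.φ h) = M.lab h + 1) :
    Q.Dec (Q.φ (ε (M.φ h))) := by
  have h1 := D.φ_φ_ε_φ_of_lab_eq_add_one hh
  have h2 := D.lab_α h
  have h3 := (Q.dec_iff _).1 (D.dec (M.φ h))
  have h4 := D.lab (M.φ h)
  rw [Q.dec_iff, h1]
  omega

theorem σ_α_of_lab_eq_sub_one (D : IsDrawing Q M ε) {h : H} (hh : M.lab (M.φ h) = M.lab h - 1) :
    Q.σ (Q.α (ε h)) = ε (M.α h) := by
  rw [M.lab_φ] at hh
  have h1 := D.φ_α_of_lab_eq_add_one (h := M.α h) (by rw [M.α_invol]; omega)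
  rw [M.α_invol] at h1
  rw [← h1, Q.φ_α]

theorem σ_α_of_lab_eq (D : IsDrawing Q M ε) {h : H} (hh : M.lab (M.φ h) = M.lab h) :
    Q.σ (Q.α (ε h)) = Q.α (ε (M.φ h)) := by
  rw [← D.φ_ε_φ_of_lab_eq hh, Q.σ_φ]

end IsDrawing

namespace LabeledQuad

/-- Turning clockwise from the end of the half-edge `e`, the half-edge `e'` is the first decreasing
one. -/
def Leads {E : Type} (Q : LabeledQuad E) (e e' : E) : Prop :=
  Q.Dec e' ∧ ∃ n, Q.σ^[n + 1] e' = Q.α e ∧ ∀ j < n, ¬ Q.Dec (Q.σ^[j + 1] e')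

theorem Leads.unique {E : Type} {Q : LabeledQuad E} {e e₁ e₂ : E} (h₁ : Q.Leads e e₁)
    (h₂ : Q.Leads e e₂) : e₁ = e₂ := by
  obtain ⟨d₁, n₁, h₁, h₁'⟩ := h₁
  obtain ⟨d₂, n₂, h₂, h₂'⟩ := h₂
  wlog hle : n₁ ≤ n₂ generalizing e₁ e₂ n₁ n₂
  · exact (this d₂ n₂ h₂ h₂' d₁ n₁ h₁ h₁' (by omega)).symm
  obtain ⟨r, rfl⟩ := Nat.exists_eq_add_of_le' hle
  have h3 : Q.σ^[n₁ + 1] e₁ = Q.σ^[n₁ + 1] (Q.σ^[r] e₂) := by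
    rw [← Function.iterate_add_apply, show n₁ + 1 + r = r + n₁ + 1 by ring, h₁, h₂]
  have h4 := Q.σ.injective.iterate _ h3
  rcases r with _ | r
  · exact h4
  · exact absurd (h4 ▸ d₁) (h₂' r (by omega))

theorem Leads.sameCycle {E : Type} {Q : LabeledQuad E} {e e' : E} (h : Q.Leads e e') :
    Q.σ.SameCycle e' (Q.α e) := by
  obtain ⟨-, n, h, -⟩ := h
  exact h ▸ Equiv.Perm.sameCycle_iterate _ _ _

end LabeledQuad

namespace IsDrawing

variable {E H : Type} {Q : LabeledQuad E} {M : LabeledRotation H} {ε : H → E}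

theorem leads_φ_of_lab_eq_add_one (D : IsDrawing Q M ε) {h : H} (hh : M.lab (M.φ h) = M.lab h + 1) :
    Q.Leads (ε (M.φ h)) (Q.φ (ε (M.φ h))) :=
  ⟨D.dec_φ_ε_φ_of_lab_eq_add_one hh, 0, Q.σ_φ _, by simp⟩

theorem leads_of_leads_σ (D : IsDrawing Q M ε) {h h' : H} {e : E}
    (hh : Q.σ (Q.α (ε h)) = Q.α (ε h'))
    (he : Q.Leads (ε h') e) : Q.Leads (ε h) e := by
  obtain ⟨hd, n, hn, hn'⟩ := he
  rw [← hh, Function.iterate_succ_apply'] at hn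
  have h2 := Q.σ.injective hn
  rcases n with _ | n
  · exact absurd (h2 ▸ hd) (D.not_dec h)
  · exact ⟨hd, n, h2, fun j hj => hn' j (by omega)⟩

/-- The decreasing half-edge attached to the successor of `h` is the one that follows `ε h`. -/
theorem leads_of_isSucc (D : IsDrawing Q M ε) {h g : H} (hg : M.IsSucc h g) : Q.Leads (ε h)
    (ε g) := by
  refine hg.induction (P := fun h g => Q.Leads (ε h) (ε g)) (fun h hh => ?_) (fun h g hh ih => ?_)
    (fun h g g' hh ih ih' => ?_)
  · refine ⟨D.dec _, ?_⟩
    obtain ⟨n, hn, hn'⟩ := D.next (M.φ h)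
    rw [M.σ_φ, ← D.σ_α_of_lab_eq_sub_one hh, Function.iterate_succ_apply'] at hn
    have h2 := Q.σ.injective hn
    rcases n with _ | n
    · exact absurd h2 (D.ne _ _)
    · exact ⟨n, h2, fun j hj => hn' j (by omega)⟩
  · exact D.leads_of_leads_σ (D.σ_α_of_lab_eq hh) ih
  · have h1 := ih.unique (D.leads_φ_of_lab_eq_add_one hh)
    refine D.leads_of_leads_σ ?_ ih'
    rw [h1, ← D.φ_φ_ε_φ_of_lab_eq_add_one hh, Q.σ_φ]

theorem φ_ε_φ_of_isSucc (D : IsDrawing Q M ε) {h g : H} (hh : M.lab (M.φ h) = M.lab h + 1)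
    (hg : M.IsSucc (M.φ h) g) :
    Q.φ (ε (M.φ h)) = ε g :=
  (D.leads_φ_of_lab_eq_add_one hh).unique (D.leads_of_isSucc hg)

theorem φ_ε_of_isSucc (D : IsDrawing Q M ε) {h g : H} (hh : M.lab (M.φ h) = M.lab h + 1)
    (hg : M.IsSucc (M.φ h) g) :
    Q.φ (ε g) = Q.α (ε h) := by
  rw [← D.φ_ε_φ_of_isSucc hh hg, D.φ_φ_ε_φ_of_lab_eq_add_one hh]

theorem σ_α_of_isSucc (D : IsDrawing Q M ε) {h g : H} (hh : M.lab (M.φ h) = M.lab h + 1)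
    (hg : M.IsSucc (M.φ h) g) :
    Q.σ (Q.α (ε h)) = Q.α (ε g) := by
  rw [← D.φ_ε_of_isSucc hh hg, Q.σ_φ]

/-- The four corners of a face. -/
theorem exists_face (D : IsDrawing Q M ε) (e : E) [Finite H] :
    ∃ h, (M.lab (M.φ h) = M.lab h ∧ (e = Q.α (ε h) ∨ e = ε (M.φ h))) ∨
      (M.lab (M.φ h) = M.lab h + 1 ∧ (e = Q.α (ε h) ∨ e = Q.α (ε (M.α h)) ∨ e = ε (M.φ h) ∨
        ∃ g, M.IsSucc (M.φ h) g ∧ e = ε g)) := by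
  have inc : ∀ h e, e = Q.α (ε h) → ∃ h, (M.lab (M.φ h) = M.lab h ∧
      (e = Q.α (ε h) ∨ e = ε (M.φ h))) ∨ (M.lab (M.φ h) = M.lab h + 1 ∧ (e = Q.α (ε h) ∨
        e = Q.α (ε (M.α h)) ∨ e = ε (M.φ h) ∨ ∃ g, M.IsSucc (M.φ h) g ∧ e = ε g)) := by
    intro h e he
    rcases M.lab_φ_cases h with hh | hh | hh
    · refine ⟨M.α h, Or.inr ⟨?_, Or.inr (Or.inl ?_)⟩⟩
      · rw [M.lab_φ] at hh ⊢
        rw [M.α_invol]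
        omega
      · rw [M.α_invol, he]
    · exact ⟨h, Or.inl ⟨hh, Or.inl he⟩⟩
    · exact ⟨h, Or.inr ⟨hh, Or.inl he⟩⟩
  by_cases he : Q.Dec e
  · by_cases he' : Q.Dec (Q.φ e)
    · have he2 : ¬ Q.Dec (Q.φ (Q.φ e)) := fun he2 => by
        rw [Q.dec_iff] at he he' he2
        have := Q.lab_φ_cases (Q.φ (Q.φ (Q.φ e)))
        rw [Q.φ_four] at this
        omega
      have he3 : ¬ Q.Dec (Q.φ (Q.φ (Q.φ e))) := fun he3 => by
        rw [Q.dec_iff] at he he' he3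
        have := Q.lab_φ_cases (Q.φ (Q.φ e))
        rw [Q.φ_four] at he3
        omega
      obtain ⟨h, hh⟩ := D.exists_of_not_dec he2
      rw [Q.not_dec_iff] at he2 he3
      rw [Q.dec_iff] at he he'
      have hl : M.lab (M.φ h) = M.lab h + 1 := by
        rw [M.lab_φ]
        rcases D.face_cases h with hc | hc | hc
        · exact hc.1
        · have h5 := hc.2
          rw [hh, Q.φ_four] at h5
          exact absurd (Q.dec_iff _ |>.2 he) (h5 ▸ D.not_dec _)
        · have h5 := hc.2
          rw [hh] at h5
          have h6 := Q.φ.injective h5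
          exact absurd (Q.dec_iff _ |>.2 he') (h6 ▸ D.not_dec _)
      refine ⟨h, Or.inr ⟨hl, Or.inr (Or.inr (Or.inl ?_))⟩⟩
      rw [← D.φ_α_ε_α_of_lab_eq_add_one hl, ← D.φ_α_of_lab_eq_add_one (M.lab_φ h ▸ hl), hh,
        Q.φ_four]
    · obtain ⟨h, hh⟩ := D.exists_of_not_dec he'
      rcases M.lab_φ_cases h with hl | hl | hl
      · have h5 := D.φ_α_of_lab_eq_add_one (h := M.α h) (by
          rw [M.lab_φ] at hl
          rw [M.α_invol]; omega)
        rw [M.α_invol, hh] at h5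
        exact absurd he (Q.φ.injective h5 ▸ D.not_dec _)
      · refine ⟨h, Or.inl ⟨hl, Or.inr ?_⟩⟩
        apply Q.φ.injective
        rw [D.φ_ε_φ_of_lab_eq hl, hh]
      · obtain ⟨g, hg⟩ := LabeledRotation.exists_isSucc_φ hl
        refine ⟨h, Or.inr ⟨hl, Or.inr (Or.inr (Or.inr ⟨g, hg, ?_⟩))⟩⟩
        apply Q.φ.injective
        rw [D.φ_ε_of_isSucc hl hg, hh]
  · obtain ⟨h, hh⟩ := D.exists_of_not_dec he
    exact inc h e hh.symm

/-! #### Sources -/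

theorem exists_σ_α_of_isMin (D : IsDrawing Q M ε) [Finite H] {h : H} (hm : M.IsMin h) :
    ∃ g, Q.σ (Q.α (ε h)) = Q.α (ε g) ∧ M.IsMin g ∧ M.φ.SameCycle h g := by
  rcases M.lab_φ_cases h with hh | hh | hh
  · exact absurd hm (LabeledRotation.isSucc_φ hh).not_isMin
  · have hs : M.φ.SameCycle h (M.φ h) := (Equiv.Perm.SameCycle.refl M.φ h).apply_right
    exact ⟨M.φ h, D.σ_α_of_lab_eq hh, hm.of_sameCycle hs hh, hs⟩
  · obtain ⟨g, hg⟩ := LabeledRotation.exists_isSucc_φ hh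
    have hs : M.φ.SameCycle h g := hg.sameCycle.of_apply_left
    exact ⟨g, D.σ_α_of_isSucc hh hg, hm.of_sameCycle hs (by have := hg.lab_eq; omega), hs⟩

theorem exists_of_isMin_of_sameCycle (D : IsDrawing Q M ε) [Finite E] [Finite H] {h : H}
    (hm : M.IsMin h) {e : E}
    (he : Q.σ.SameCycle (Q.α (ε h)) e) :
    ∃ g, e = Q.α (ε g) ∧ M.IsMin g ∧ M.φ.SameCycle h g := by
  obtain ⟨n, rfl⟩ := he.exists_iterate_eq
  clear he
  induction n with
  | zero => exact ⟨h, rfl, hm, .rfl⟩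
  | succ n ih =>
    obtain ⟨g, hg, hgm, hs⟩ := ih
    obtain ⟨g', hg', hgm', hs'⟩ := D.exists_σ_α_of_isMin hgm
    exact ⟨g', by rw [Function.iterate_succ_apply', hg, hg'], hgm', hs.trans hs'⟩

/-- A corner has minimal label in its face if and only if the half-edge drawn from it ends at a
local minimum of the labels. -/
theorem isMin_iff (D : IsDrawing Q M ε) [Finite E] [Finite H] {h : H} :
    M.IsMin h ↔ ∀ e, Q.σ.SameCycle (Q.α (ε h)) e → ¬ Q.Dec e := by
  constructor
  · intro hm e he
    obtain ⟨g, rfl, -⟩ := D.exists_of_isMin_of_sameCycle hm he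
    exact D.not_dec g
  · intro hd
    refine (LabeledRotation.isMin_or_exists_isSucc h).resolve_right ?_
    rintro ⟨g, hg⟩
    exact hd _ (D.leads_of_isSucc hg).sameCycle.symm (D.dec g)

theorem sameCycle_of_isMin (D : IsDrawing Q M ε) [Finite H] {h g : H} (hm : M.IsMin h)
    (hg : M.IsMin g)
    (hs : M.φ.SameCycle h g) : Q.σ.SameCycle (Q.α (ε h)) (Q.α (ε g)) := by
  obtain ⟨n, hn⟩ := hs.exists_iterate_eq
  induction n using Nat.strong_induction_on generalizing h with
  | _ n ih =>
    have hl : M.lab g = M.lab h := le_antisymm (hg.le hs.symm) (hm.le hs)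
    rcases n with _ | n
    · obtain rfl : h = g := hn
      exact .rfl
    rcases M.lab_φ_cases h with hh | hh | hh
    · exact absurd hm (LabeledRotation.isSucc_φ hh).not_isMin
    · have hs' : M.φ.SameCycle h (M.φ h) := (Equiv.Perm.SameCycle.refl M.φ h).apply_right
      have := ih n (by omega) (hm.of_sameCycle hs' hh) (hs'.symm.trans hs) hn
      rw [← D.σ_α_of_lab_eq hh] at this
      exact this.of_apply_left
    · obtain ⟨g', hg'⟩ := LabeledRotation.exists_isSucc_φ hh
      have hs' : M.φ.SameCycle h g' := hg'.sameCycle.of_apply_left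
      have hm' : M.IsMin g' := hm.of_sameCycle hs' (by have := hg'.lab_eq; omega)
      obtain ⟨r, hr⟩ := id hg'
      have hrn : r + 1 ≤ n := by
        by_contra hlt
        have h1 := hr.2.2 n (by omega)
        rw [show M.φ^[n] (M.φ h) = g from hn] at h1
        omega
      obtain ⟨p, rfl⟩ := Nat.exists_eq_add_of_le' hrn
      have := ih p (by omega) hm' (hs'.symm.trans hs) (by
        rw [← hr.1, ← Function.iterate_add_apply]
        exact hn)
      rw [← D.σ_α_of_isSucc hh hg'] at this
      exact this.of_apply_left

/-! #### Vertices -/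

theorem sameCycle_ε (D : IsDrawing Q M ε) {h h' : H} [Finite H] (hs : M.σ.SameCycle h h') :
    Q.σ.SameCycle (ε h) (ε h') := by
  obtain ⟨n, rfl⟩ := hs.exists_iterate_eq
  clear hs
  induction n with
  | zero => exact .rfl
  | succ n ih =>
    obtain ⟨r, hr, -⟩ := D.next (M.σ^[n] h)
    rw [Function.iterate_succ_apply', ← hr]
    exact ih.trans (Equiv.Perm.sameCycle_iterate _ _ _)

theorem sameCycle_ε_iff (D : IsDrawing Q M ε) {h h' : H} [Finite E] [Finite H] :
    Q.σ.SameCycle (ε h) (ε h') ↔ M.σ.SameCycle h h' := by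
  refine ⟨fun hs => ?_, D.sameCycle_ε⟩
  obtain ⟨n, hn⟩ := hs.exists_iterate_eq
  clear hs
  induction n using Nat.strong_induction_on generalizing h with
  | _ n ih =>
    rcases n with _ | n
    · exact (D.inj hn) ▸ .rfl
    obtain ⟨r, hr, hr'⟩ := D.next h
    have hle : r ≤ n := by
      by_contra hlt
      exact hr' n (by omega) (hn ▸ D.dec h')
    obtain ⟨p, rfl⟩ := Nat.exists_eq_add_of_le' hle
    have := ih p (by omega) (h := M.σ h) (by
      rw [← hr, ← Function.iterate_add_apply]
      exact hn)
    exact this.of_apply_left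

/-! #### Connectedness -/

/-- A property of the half-edges of `M` that is constant on its components gives such a property
of those of `Q`. -/
theorem iff_of_connected (D : IsDrawing Q M ε) [Finite H]
    (hQ : ∀ P : E → Prop, (∀ e, P e → P (Q.σ e)) → (∀ e, P e → P (Q.α e)) → ∀ e e', P e → P e')
    (P : H → Prop) (hσ : ∀ h, P (M.σ h) ↔ P h) (hα : ∀ h, P (M.α h) ↔ P h) (h h' : H)
    (hP : P h) : P h' := by
  have hφ : ∀ h, P (M.φ h) ↔ P h := fun h => by rw [← hσ, M.σ_φ, hα]
  have hsucc : ∀ {h g}, M.IsSucc h g → (P g ↔ P h) := fun {h g} hg => by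
    obtain ⟨n, hn⟩ := hg.sameCycle.exists_iterate_eq
    subst hn
    clear hg
    induction n with
    | zero => rfl
    | succ n ih => rw [Function.iterate_succ_apply', hφ, ih]
  let P' : E → Prop := fun e => ∀ g, e = ε g ∨ e = Q.α (ε g) → P g
  have hdec : ∀ g, P' (ε g) ↔ P g := fun g => by
    refine ⟨fun hp => hp g (Or.inl rfl), fun hp g' hg' => ?_⟩
    rcases hg' with hg' | hg'
    · exact D.inj hg' ▸ hp
    · exact absurd hg' (D.ne _ _)
  have hinc : ∀ g, P' (Q.α (ε g)) ↔ P g := fun g => by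
    refine ⟨fun hp => hp g (Or.inr rfl), fun hp g' hg' => ?_⟩
    rcases hg' with hg' | hg'
    · exact absurd hg'.symm (D.ne _ _)
    · exact D.inj (Q.α.injective hg') ▸ hp
  have hface : ∀ e, P' (Q.φ e) ↔ P' e := by
    intro e
    obtain ⟨h, ⟨hh, hc⟩ | ⟨hh, hc⟩⟩ := D.exists_face e
    · rcases hc with rfl | rfl
      · rw [D.φ_α_of_lab_le (by rw [← M.lab_φ, hh]), hinc, hdec, hφ, hα]
      · rw [D.φ_ε_φ_of_lab_eq hh, hinc, hdec, hφ]
    · rcases hc with rfl | rfl | rfl | ⟨g, hg, rfl⟩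
      · rw [D.φ_α_of_lab_eq_add_one (M.lab_φ h ▸ hh), hinc, hinc, hα]
      · rw [D.φ_α_ε_α_of_lab_eq_add_one hh, hinc, hdec, hφ, hα]
      · obtain ⟨g, hg⟩ := LabeledRotation.exists_isSucc_φ hh
        rw [D.φ_ε_φ_of_isSucc hh hg, hdec, hdec, hsucc hg]
      · rw [D.φ_ε_of_isSucc hh hg, hinc, hdec, hsucc hg, hφ]
  have hP'α : ∀ e, P' (Q.α e) ↔ P' e := fun e => by
    by_cases he : Q.Dec e
    · obtain ⟨g, rfl⟩ := (D.dec_iff e).1 he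
      rw [hdec, hinc]
    · obtain ⟨g, rfl⟩ := D.exists_of_not_dec he
      rw [Q.α_invol, hdec, hinc]
  have hP'σ : ∀ e, P' (Q.σ e) ↔ P' e := fun e => by
    rw [← hP'α, ← hface, Q.φ_α_σ]
  exact (hdec h').1 (hQ P' (fun e => (hP'σ e).2) (fun e => (hP'α e).2) (ε h) (ε h')
    ((hdec h).2 hP))

/-- If `M` is connected, so is `Q`. -/
theorem connected_of_connected (D : IsDrawing Q M ε) [Finite E] [Finite H]
    (hM : ∀ P : H → Prop, (∀ h, P h → P (M.σ h)) → (∀ h, P h → P (M.α h)) → ∀ h h', P h → P h')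
    (P : E → Prop) (hσ : ∀ e, P (Q.σ e) ↔ P e) (hα : ∀ e, P (Q.α e) ↔ P e) (e e' : E)
    (hP : P e) : P e' := by
  have hφ : ∀ e, P (Q.φ e) ↔ P e := fun e => by rw [← hσ, Q.σ_φ, hα]
  have hit : ∀ n e, P (Q.σ^[n] e) ↔ P e := fun n e => by
    induction n with
    | zero => rfl
    | succ n ih => rw [Function.iterate_succ_apply', hσ, ih]
  have hMσ : ∀ h, P (ε (M.σ h)) ↔ P (ε h) := fun h => by
    obtain ⟨n, hn, -⟩ := D.next h
    rw [← hn, hit]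
  have hMα : ∀ h, P (ε (M.α h)) ↔ P (ε h) := fun h => by
    rw [← hα, ← hα (ε h)]
    rcases D.swap h with hs | hs | hs
    · rw [← hs, hφ]
    · rw [← hs, hφ, hφ]
    · rw [← hs, hφ, hφ, hφ]
  have hall : ∀ e, ∃ h, P e ↔ P (ε h) := fun e => by
    by_cases he : Q.Dec e
    · obtain ⟨g, rfl⟩ := (D.dec_iff e).1 he
      exact ⟨g, Iff.rfl⟩
    · obtain ⟨g, rfl⟩ := D.exists_of_not_dec he
      exact ⟨g, hα _⟩
  obtain ⟨h, hh⟩ := hall e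
  obtain ⟨h', hh'⟩ := hall e'
  exact hh'.2 (hM (fun h => P (ε h)) (fun h => (hMσ h).2) (fun h => (hMα h).2) h h' (hh.1 hP))

end IsDrawing

/-! ### The map drawn on a labeled quadrangulation -/

/-- The permutation induced by `f` on a subset, by the first return. -/
theorem Equiv.Perm.exists_firstReturn {X : Type*} [Finite X] (f : Equiv.Perm X) (p : X → Prop) :
    ∃ τ : Equiv.Perm {x // p x}, ∀ x, ∃ n, f^[n + 1] x.1 = (τ x).1 ∧
      ∀ j < n, ¬ p (f^[j + 1] x.1) := by
  classical
  have hex : ∀ x : {x // p x}, ∃ n, p (f^[n + 1] x.1) := fun x => by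
    obtain ⟨n, hpos, -, hn⟩ := (Equiv.Perm.SameCycle.refl f x.1).exists_pow_eq''
    refine ⟨n - 1, ?_⟩
    rw [Nat.sub_add_cancel hpos, Equiv.Perm.iterate_eq_pow, hn]
    exact x.2
  let t : {x // p x} → {x // p x} := fun x => ⟨f^[Nat.find (hex x) + 1] x.1, Nat.find_spec (hex x)⟩
  have ht : Function.Injective t := by
    intro x y hxy
    wlog hle : Nat.find (hex x) ≤ Nat.find (hex y) generalizing x y
    · exact (this hxy.symm (by omega)).symm
    obtain ⟨r, hr⟩ := Nat.exists_eq_add_of_le' hle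
    have h1 : f^[Nat.find (hex x) + 1] x.1 = f^[Nat.find (hex x) + 1] (f^[r] y.1) := by
      rw [← Function.iterate_add_apply,
        show Nat.find (hex x) + 1 + r = r + Nat.find (hex x) + 1 by ring, ← hr]
      exact congrArg Subtype.val hxy
    have h2 : x.1 = f^[r] y.1 := f.injective.iterate _ h1
    rcases r with _ | r
    · exact Subtype.ext h2
    · exact absurd (h2 ▸ x.2) (Nat.find_min (hex y) (m := r) (by omega))
  exact ⟨Equiv.ofBijective t (Finite.injective_iff_bijective.1 ht), fun x =>
    ⟨Nat.find (hex x), rfl, fun j hj => Nat.find_min (hex x) hj⟩⟩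

namespace LabeledQuad

variable {E : Type} (Q : LabeledQuad E)

/-- A face has only two increasing half-edges. -/
theorem partner_unique {e e₁ e₂ : E} (he : ¬ Q.Dec e) (h₁ : ¬ Q.Dec e₁) (h₂ : ¬ Q.Dec e₂)
    (hs₁ : Q.φ e = e₁ ∨ Q.φ (Q.φ e) = e₁ ∨ Q.φ (Q.φ (Q.φ e)) = e₁)
    (hs₂ : Q.φ e = e₂ ∨ Q.φ (Q.φ e) = e₂ ∨ Q.φ (Q.φ (Q.φ e)) = e₂) : e₁ = e₂ := by
  rw [not_dec_iff] at he h₁ h₂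
  have l2 := Q.lab_φ_cases (Q.φ e)
  have l3 := Q.lab_φ_cases (Q.φ (Q.φ e))
  have l4 := Q.lab_φ_cases (Q.φ (Q.φ (Q.φ e)))
  have h4 := Q.φ_four e
  rw [h4] at l4
  rcases hs₁ with rfl | rfl | rfl <;> rcases hs₂ with rfl | rfl | rfl <;>
    first
    | rfl
    | (exfalso; try rw [h4] at h₁
       try rw [h4] at h₂
       omega)

open Classical in
/-- The other increasing half-edge of the face of an increasing half-edge. -/
noncomputable def partner (e : E) : E :=
  if Q.Dec (Q.φ e) then if Q.Dec (Q.φ (Q.φ e)) then Q.φ (Q.φ (Q.φ e)) else Q.φ (Q.φ e) else Q.φ e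

theorem partner_cases (e : E) :
    Q.φ e = Q.partner e ∨ Q.φ (Q.φ e) = Q.partner e ∨ Q.φ (Q.φ (Q.φ e)) = Q.partner e := by
  unfold partner
  split_ifs <;> simp

theorem not_dec_partner {e : E} (he : ¬ Q.Dec e) : ¬ Q.Dec (Q.partner e) := by
  unfold partner
  split_ifs with h1 h2
  · rw [Q.dec_iff] at h1 h2 ⊢
    rw [Q.not_dec_iff] at he
    rw [Q.φ_four]
    have l3 := Q.lab_φ_cases (Q.φ (Q.φ (Q.φ e)))
    rw [Q.φ_four] at l3
    omega
  · exact h2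
  · exact h1

theorem partner_partner {e : E} (he : ¬ Q.Dec e) : Q.partner (Q.partner e) = e := by
  have h1 := Q.not_dec_partner he
  refine Q.partner_unique h1 (Q.not_dec_partner h1) he (Q.partner_cases _) ?_
  have h4 := Q.φ_four e
  rcases Q.partner_cases e with h | h | h <;> rw [← h] <;> simp [h4]

theorem abs_lab_partner_sub_le {e : E} (he : ¬ Q.Dec e) : |Q.lab (Q.partner e) - Q.lab e| ≤ 1 := by
  have h1 := Q.not_dec_partner he
  rw [not_dec_iff] at he h1
  have l2 := Q.lab_φ_cases (Q.φ e)
  have l3 := Q.lab_φ_cases (Q.φ (Q.φ e))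
  have l4 := Q.lab_φ_cases (Q.φ (Q.φ (Q.φ e)))
  have h4 := Q.φ_four e
  rw [h4] at l4
  rw [abs_le]
  rcases Q.partner_cases e with h | h | h <;> rw [← h] at h1 ⊢ <;> try rw [h4] at h1
  all_goals constructor <;> omega

/-- The map whose edges join the increasing half-edges of each face. -/
theorem exists_isDrawing [Finite E] :
    ∃ M : LabeledRotation {e // Q.Dec e}, IsDrawing Q M Subtype.val := by
  obtain ⟨τ, hτ⟩ := Q.σ.exists_firstReturn Q.Dec
  have hinc : ∀ e : {e // Q.Dec e}, ¬ Q.Dec (Q.α e.1) := fun e => by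
    rw [Q.dec_α_iff, not_not]
    exact e.2
  let a : {e // Q.Dec e} → {e // Q.Dec e} := fun e =>
    ⟨Q.α (Q.partner (Q.α e.1)), (Q.dec_α_iff _).2 (Q.not_dec_partner (hinc e))⟩
  have ha : Function.Involutive a := fun e => Subtype.ext (by
    change Q.α (Q.partner (Q.α (Q.α (Q.partner (Q.α e.1))))) = e.1
    rw [Q.α_invol, Q.partner_partner (hinc e), Q.α_invol])
  have hlab : ∀ e : {e // Q.Dec e}, Q.lab e.1 = Q.lab (Q.α e.1) + 1 := fun e => by
    have : Q.lab (Q.α e.1) = Q.lab e.1 - 1 := e.2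
    omega
  refine ⟨⟨⟨τ, ha.toPerm, (ha.toPerm * τ)⁻¹, fun e => ?_, ha⟩, fun e => Q.lab e.1, fun e => ?_,
    fun e => ?_⟩, Subtype.val_injective, fun e => ?_, fun _ => rfl, fun e => ?_, hτ⟩
  · exact (ha.toPerm * τ).symm_apply_apply e
  · obtain ⟨n, hn, -⟩ := hτ e
    change Q.lab (τ e).1 = _
    rw [← hn]
    exact Q.lab_eq_of_sameCycle (Equiv.Perm.sameCycle_iterate _ _ _)
  · have h1 := hlab e
    have h2 := hlab (a e)
    have h3 : Q.α (a e).1 = Q.partner (Q.α e.1) := Q.α_invol _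
    have h4 := Q.abs_lab_partner_sub_le (hinc e)
    change |Q.lab (a e).1 - Q.lab e.1| ≤ 1
    rw [h2, h1, h3]
    simpa using h4
  · simp
  · change Q.φ (Q.α e.1) = Q.α (a e).1 ∨ _ = Q.α (a e).1 ∨ _ = Q.α (a e).1
    rw [show Q.α (a e).1 = Q.partner (Q.α e.1) from Q.α_invol _]
    exact Q.partner_cases _

end LabeledQuad

/-! ### Uniqueness of drawings -/

namespace IsDrawing

/-- The map drawn on a labeled quadrangulation is unique. -/
theorem exists_equiv_map {E H H' : Type} {Q : LabeledQuad E} {M : LabeledRotation H}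
    {M' : LabeledRotation H'} {ε : H → E} {ε' : H' → E} (D : IsDrawing Q M ε)
    (D' : IsDrawing Q M' ε') :
    ∃ G : H ≃ H', (∀ h, ε' (G h) = ε h) ∧ (∀ h, G (M.σ h) = M'.σ (G h)) ∧
      (∀ h, G (M.α h) = M'.α (G h)) ∧ ∀ h, G (M.φ h) = M'.φ (G h) := by
  choose G hG using fun h => (D'.dec_iff _).1 (D.dec h)
  choose G' hG' using fun h => (D.dec_iff _).1 (D'.dec h)
  let F : H ≃ H' := ⟨G, G', fun h => D.inj (by rw [hG', hG]), fun h => D'.inj (by rw [hG, hG'])⟩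
  have hF : ∀ h, ε' (F h) = ε h := hG
  have hσ : ∀ h, F (M.σ h) = M'.σ (F h) := fun h => by
    apply D'.inj
    obtain ⟨n, hn, hn'⟩ := D.next h
    obtain ⟨r, hr, hr'⟩ := D'.next (F h)
    rw [hF] at hr hr' ⊢
    rw [← hn, ← hr]
    rcases lt_trichotomy n r with hlt | rfl | hlt
    · exact absurd (hn ▸ D.dec _) (hr' n hlt)
    · rfl
    · exact absurd (hr ▸ D'.dec _) (hn' r hlt)
  have hα : ∀ h, F (M.α h) = M'.α (F h) := fun h => by
    apply D'.inj
    rw [hF]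
    apply Q.α.injective
    refine Q.partner_unique (D.not_dec h) (D.not_dec _) (D'.not_dec _) (D.swap h) ?_
    rw [← hF h]
    exact D'.swap (F h)
  refine ⟨F, hF, hσ, hα, fun h => ?_⟩
  apply M'.σ.injective
  rw [← hσ, M.σ_φ, M'.σ_φ, hα]

/-- Each half-edge of the quadrangulation, or its reversal, corresponds to one of the map. -/
theorem bijective_elim {E H : Type} {Q : LabeledQuad E} {M : LabeledRotation H}
    {ε : H → E} (D : IsDrawing Q M ε) : Function.Bijective (Sum.elim ε fun h => Q.α (ε h)) := by
  refine ⟨?_, fun e => ?_⟩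
  · rintro (h | h) (h' | h') hh
    · exact congrArg _ (D.inj hh)
    · exact absurd hh (D.ne _ _)
    · exact absurd hh.symm (D.ne _ _)
    · exact congrArg _ (D.inj (Q.α.injective hh))
  · by_cases he : Q.Dec e
    · obtain ⟨h, hh⟩ := (D.dec_iff e).1 he
      exact ⟨Sum.inl h, hh⟩
    · obtain ⟨h, hh⟩ := D.exists_of_not_dec he
      exact ⟨Sum.inr h, hh⟩

/-- A drawing can be transported along isomorphisms, with a common shift of all labels. -/
theorem map {E E' H H' : Type} {Q : LabeledQuad E} {Q' : LabeledQuad E'} {M : LabeledRotation H}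
    {M' : LabeledRotation H'} {ε : H → E} (D : IsDrawing Q M ε) (F : E ≃ E') (G : H' ≃ H) (c : ℤ)
    (hFσ : ∀ e, F (Q.σ e) = Q'.σ (F e)) (hFα : ∀ e, F (Q.α e) = Q'.α (F e))
    (hFφ : ∀ e, F (Q.φ e) = Q'.φ (F e)) (hGσ : ∀ h, G (M'.σ h) = M.σ (G h))
    (hGα : ∀ h, G (M'.α h) = M.α (G h)) (hFlab : ∀ e, Q'.lab (F e) = Q.lab e + c)
    (hGlab : ∀ h, M'.lab h = M.lab (G h) + c) :
    IsDrawing Q' M' fun h => F (ε (G h)) := by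
  have hit : ∀ n e, Q'.σ^[n] (F e) = F (Q.σ^[n] e) := fun n e => by
    induction n with
    | zero => rfl
    | succ n ih => rw [Function.iterate_succ_apply', Function.iterate_succ_apply', ih, hFσ]
  have hdec : ∀ e, Q'.Dec (F e) ↔ Q.Dec e := fun e => by
    rw [LabeledQuad.Dec, LabeledQuad.Dec, ← hFα, hFlab, hFlab]
    omega
  refine ⟨fun h h' hh => G.injective (D.inj (F.injective hh)), fun e => ?_, fun h => ?_,
    fun h => ?_, fun h => ?_⟩
  · obtain ⟨e, rfl⟩ := F.surjective e
    rw [hdec, D.dec_iff, ← G.exists_congr_right]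
    simp
  · rw [hGlab, hFlab, D.lab]
  · simp only [hGα, ← hFα, ← hFφ, EmbeddingLike.apply_eq_iff_eq]
    exact D.swap (G h)
  · obtain ⟨n, hn, hn'⟩ := D.next (G h)
    refine ⟨n, ?_, fun j hj => ?_⟩
    · rw [hit, hn, hGσ]
    · rw [hit, hdec]
      exact hn' j hj

/-- The labeled quadrangulation on which a map is drawn is unique. -/
theorem exists_equiv_quad {E E' H : Type} [Finite H] {Q : LabeledQuad E} {Q' : LabeledQuad E'}
    {M : LabeledRotation H} {ε : H → E} {ε' : H → E'} (D : IsDrawing Q M ε)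
    (D' : IsDrawing Q' M ε') :
    ∃ F : E ≃ E', (∀ h, F (ε h) = ε' h) ∧ (∀ e, F (Q.σ e) = Q'.σ (F e)) ∧
      (∀ e, F (Q.α e) = Q'.α (F e)) ∧ ∀ e, F (Q.φ e) = Q'.φ (F e) := by
  let F : E ≃ E' := (Equiv.ofBijective _ D.bijective_elim).symm.trans
    (Equiv.ofBijective _ D'.bijective_elim)
  have hdec : ∀ h, F (ε h) = ε' h := fun h => by
    have : (Equiv.ofBijective _ D.bijective_elim).symm (ε h) = Sum.inl h :=
      (Equiv.ofBijective _ D.bijective_elim).symm_apply_apply (Sum.inl h)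
    simp [F, this]
  have hinc : ∀ h, F (Q.α (ε h)) = Q'.α (ε' h) := fun h => by
    have : (Equiv.ofBijective _ D.bijective_elim).symm (Q.α (ε h)) = Sum.inr h :=
      (Equiv.ofBijective _ D.bijective_elim).symm_apply_apply (Sum.inr h)
    simp [F, this]
  have hα : ∀ e, F (Q.α e) = Q'.α (F e) := fun e => by
    by_cases he : Q.Dec e
    · obtain ⟨h, rfl⟩ := (D.dec_iff e).1 he
      rw [hinc, hdec]
    · obtain ⟨h, rfl⟩ := D.exists_of_not_dec he
      rw [Q.α_invol, hinc, hdec, Q'.α_invol]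
  have hφ : ∀ e, F (Q.φ e) = Q'.φ (F e) := fun e => by
    obtain ⟨h, ⟨hh, hc⟩ | ⟨hh, hc⟩⟩ := D.exists_face e
    · rcases hc with rfl | rfl
      · have hl : M.lab (M.α h) ≤ M.lab h := by rw [← M.lab_φ, hh]
        rw [D.φ_α_of_lab_le hl, hinc, hdec, D'.φ_α_of_lab_le hl]
      · rw [D.φ_ε_φ_of_lab_eq hh, hinc, hdec, D'.φ_ε_φ_of_lab_eq hh]
    · rcases hc with rfl | rfl | rfl | ⟨g, hg, rfl⟩
      · have hl := M.lab_φ h ▸ hh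
        rw [D.φ_α_of_lab_eq_add_one hl, hinc, hinc, D'.φ_α_of_lab_eq_add_one hl]
      · rw [D.φ_α_ε_α_of_lab_eq_add_one hh, hinc, hdec, D'.φ_α_ε_α_of_lab_eq_add_one hh]
      · obtain ⟨g, hg⟩ := LabeledRotation.exists_isSucc_φ hh
        rw [D.φ_ε_φ_of_isSucc hh hg, hdec, hdec, D'.φ_ε_φ_of_isSucc hh hg]
      · rw [D.φ_ε_of_isSucc hh hg, hinc, hdec, D'.φ_ε_of_isSucc hh hg]
  refine ⟨F, hdec, fun e => ?_, hα, hφ⟩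
  apply Q'.α.injective
  apply Q'.φ.injective
  rw [← hα, ← hφ, Q.φ_α_σ, Q'.φ_α_σ]

end IsDrawing

/-! ### The quadrangulation of a labeled map -/

namespace LabeledRotation

variable {H : Type} (M : LabeledRotation H)

open Classical in
/-- A choice of successor. -/
noncomputable def next (h : H) : H := if hg : ∃ g, M.IsSucc h g then hg.choose else h

theorem next_eq {h g : H} (hg : M.IsSucc h g) : M.next h = g := by
  have hex : ∃ g, M.IsSucc h g := ⟨g, hg⟩
  rw [next, dif_pos hex]
  exact hex.choose_spec.unique hg

/-- The decreasing half-edge of the face of the quadrangulation containing `h` that is attributed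
to `h`. -/
noncomputable def closing (h : H) : H :=
  if M.lab h ≤ M.lab (M.α h) then M.φ h else M.next (M.φ (M.α h))

theorem closing_of_le {h : H} (hh : M.lab h ≤ M.lab (M.α h)) : M.closing h = M.φ h := if_pos hh

theorem isSucc_closing [Finite H] {h : H} (hh : M.lab (M.α h) = M.lab h + 1) :
    M.IsSucc (M.φ h) (M.closing (M.α h)) := by
  obtain ⟨g, hg⟩ := exists_isSucc_φ (M := M) (h := h) (by rw [M.lab_φ, hh])
  have : M.closing (M.α h) = g := by
    rw [closing, if_neg (by rw [M.α_invol]; omega), M.α_invol, M.next_eq hg]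
  exact this ▸ hg

theorem closing_injective [Finite H] : Function.Injective M.closing := by
  have hkey : ∀ h h', M.lab h ≤ M.lab (M.α h) → ¬ M.lab h' ≤ M.lab (M.α h') →
      M.closing h ≠ M.closing h' := by
    intro h h' hh hh' heq
    have hl' : M.lab (M.α (M.α h')) = M.lab (M.α h') + 1 := by
      have := abs_le.1 (M.lab_α h')
      rw [M.α_invol]
      omega
    obtain ⟨n, hn⟩ := M.isSucc_closing hl'
    rw [M.α_invol, ← heq, M.closing_of_le hh] at hn
    have h1 := hn.1
    rw [Function.iterate_succ_apply'] at h1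
    have h2 := M.φ.injective h1
    have h3 := hn.2.2 n le_rfl
    have h4 := hn.2.1
    rw [h2] at h3
    rw [M.lab_φ h] at h4
    omega
  intro h h' heq
  by_cases hh : M.lab h ≤ M.lab (M.α h) <;> by_cases hh' : M.lab h' ≤ M.lab (M.α h')
  · rw [M.closing_of_le hh, M.closing_of_le hh'] at heq
    exact M.φ.injective heq
  · exact absurd heq (hkey _ _ hh hh')
  · exact absurd heq.symm (hkey _ _ hh' hh)
  · have hl : M.lab (M.α (M.α h)) = M.lab (M.α h) + 1 := by
      have := abs_le.1 (M.lab_α h)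
      rw [M.α_invol]
      omega
    have hl' : M.lab (M.α (M.α h')) = M.lab (M.α h') + 1 := by
      have := abs_le.1 (M.lab_α h')
      rw [M.α_invol]
      omega
    have h1 := M.isSucc_closing hl
    have h2 := M.isSucc_closing hl'
    rw [M.α_invol] at h1 h2
    rw [← heq] at h2
    exact M.α.injective (eq_of_isSucc_φ (by rw [M.lab_φ, hl]) (by rw [M.lab_φ, hl']) h1 h2)

/-- The cyclic order of the half-edges of the face of the quadrangulation that contains an edge of
`M`: `Sum.inr h` is the increasing half-edge that corresponds to `h`, and `Sum.inl h` the
decreasing half-edge attributed to `h`. -/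
def turn : H ⊕ H → H ⊕ H
  | Sum.inr h => if M.lab (M.α h) = M.lab h + 1 then Sum.inr (M.α h) else Sum.inl (M.α h)
  | Sum.inl h => if M.lab (M.α h) = M.lab h then Sum.inr h else
      if M.lab (M.α h) = M.lab h + 1 then Sum.inl (M.α h) else Sum.inr (M.α h)

theorem turn_inr_of_up {h : H} (hh : M.lab (M.α h) = M.lab h + 1) :
    M.turn (Sum.inr h) = Sum.inr (M.α h) := if_pos hh

theorem turn_inr_of_le {h : H} (hh : M.lab (M.α h) ≤ M.lab h) :
    M.turn (Sum.inr h) = Sum.inl (M.α h) := if_neg (by omega)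

theorem turn_inl_of_eq {h : H} (hh : M.lab (M.α h) = M.lab h) :
    M.turn (Sum.inl h) = Sum.inr h := if_pos hh

theorem turn_inl_of_up {h : H} (hh : M.lab (M.α h) = M.lab h + 1) :
    M.turn (Sum.inl h) = Sum.inl (M.α h) := by
  rw [turn, if_neg (by omega), if_pos hh]

theorem turn_inl_of_down {h : H} (hh : M.lab (M.α h) < M.lab h) :
    M.turn (Sum.inl h) = Sum.inr (M.α h) := by
  rw [turn, if_neg (by omega), if_neg (by omega)]

theorem lab_α_cases (h : H) : M.lab (M.α h) = M.lab h + 1 ∨ M.lab (M.α h) = M.lab h ∨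
    M.lab (M.α h) = M.lab h - 1 := by
  have := abs_le.1 (M.lab_α h)
  omega

theorem turn_four (x : H ⊕ H) : M.turn (M.turn (M.turn (M.turn x))) = x := by
  have up : ∀ h, M.lab (M.α h) = M.lab h + 1 → M.turn (Sum.inr h) = Sum.inr (M.α h) ∧
      M.turn (Sum.inr (M.α h)) = Sum.inl h ∧ M.turn (Sum.inl h) = Sum.inl (M.α h) ∧
      M.turn (Sum.inl (M.α h)) = Sum.inr h := fun h hh => by
    refine ⟨M.turn_inr_of_up hh, ?_, M.turn_inl_of_up hh, ?_⟩
    · rw [M.turn_inr_of_le (by rw [M.α_invol]; omega), M.α_invol]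
    · rw [M.turn_inl_of_down (by rw [M.α_invol]; omega), M.α_invol]
  have flat : ∀ h, M.lab (M.α h) = M.lab h → M.turn (Sum.inr h) = Sum.inl (M.α h) ∧
      M.turn (Sum.inl (M.α h)) = Sum.inr (M.α h) := fun h hh =>
    ⟨M.turn_inr_of_le hh.le, M.turn_inl_of_eq (by rw [M.α_invol, hh])⟩
  rcases x with h | h <;> rcases M.lab_α_cases h with hh | hh | hh
  · obtain ⟨h1, h2, h3, h4⟩ := up h hh
    rw [h3, h4, h1, h2]
  · obtain ⟨h1, h2⟩ := flat h hh
    obtain ⟨h3, h4⟩ := flat (M.α h) (by rw [M.α_invol, hh])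
    rw [M.α_invol] at h3 h4
    rw [h4, h1, h2, h3]
  · obtain ⟨h1, h2, h3, h4⟩ := up (M.α h) (by rw [M.α_invol]; omega)
    rw [M.α_invol] at h1 h2 h3 h4
    rw [h4, h1, h2, h3]
  · obtain ⟨h1, h2, h3, h4⟩ := up h hh
    rw [h1, h2, h3, h4]
  · obtain ⟨h1, h2⟩ := flat h hh
    obtain ⟨h3, h4⟩ := flat (M.α h) (by rw [M.α_invol, hh])
    rw [M.α_invol] at h3 h4
    rw [h1, h2, h3, h4]
  · obtain ⟨h1, h2, h3, h4⟩ := up (M.α h) (by rw [M.α_invol]; omega)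
    rw [M.α_invol] at h1 h2 h3 h4
    rw [h2, h3, h4, h1]

theorem turn_two_ne (hα : ∀ h, M.α h ≠ h) (x : H ⊕ H) : M.turn (M.turn x) ≠ x := by
  rcases x with h | h <;> rcases M.lab_α_cases h with hh | hh | hh
  · rw [M.turn_inl_of_up hh, M.turn_inl_of_down (by rw [M.α_invol]; omega)]
    simp
  · rw [M.turn_inl_of_eq hh, M.turn_inr_of_le hh.le]
    simpa using hα h
  · rw [M.turn_inl_of_down (by omega), M.turn_inr_of_up (by rw [M.α_invol]; omega)]
    simp
  · rw [M.turn_inr_of_up hh, M.turn_inr_of_le (by rw [M.α_invol]; omega)]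
    simp
  · rw [M.turn_inr_of_le hh.le, M.turn_inl_of_eq (by rw [M.α_invol, hh])]
    simpa using hα h
  · rw [M.turn_inr_of_le (by omega), M.turn_inl_of_up (by rw [M.α_invol]; omega)]
    simp

/-- The cyclic order `turn` as a permutation. -/
def turnPerm : Equiv.Perm (H ⊕ H) where
  toFun := M.turn
  invFun x := M.turn (M.turn (M.turn x))
  left_inv := M.turn_four
  right_inv := M.turn_four

/-- The identification of each decreasing half-edge attributed to `h` with the one drawn from
`closing h`. -/
noncomputable def closingPerm [Finite H] : Equiv.Perm (H ⊕ H) :=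
  Equiv.sumCongr (Equiv.ofBijective _ (Finite.injective_iff_bijective.1 M.closing_injective))
    (Equiv.refl H)

@[simp] theorem closingPerm_inl [Finite H] (h : H) :
    M.closingPerm (Sum.inl h) = Sum.inl (M.closing h) := rfl

@[simp] theorem closingPerm_inr [Finite H] (h : H) :
    M.closingPerm (Sum.inr h) = Sum.inr h := rfl

/-- The permutation whose cycles are the faces of the quadrangulation. -/
noncomputable def faceTurn [Finite H] : Equiv.Perm (H ⊕ H) :=
  M.closingPerm.symm.trans (M.turnPerm.trans M.closingPerm)

theorem faceTurn_closingPerm [Finite H] (x : H ⊕ H) :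
    M.faceTurn (M.closingPerm x) = M.closingPerm (M.turn x) := by
  simp [faceTurn, turnPerm]

/-- The label of a half-edge of the quadrangulation. -/
def quadLab : H ⊕ H → ℤ
  | Sum.inl h => M.lab h
  | Sum.inr h => M.lab h - 1

theorem quadLab_faceTurn [Finite H] (x : H ⊕ H) : M.quadLab (M.faceTurn x) = M.quadLab x.swap := by
  obtain ⟨x, rfl⟩ := M.closingPerm.surjective x
  rw [faceTurn_closingPerm]
  rcases x with h | h <;> rcases M.lab_α_cases h with hh | hh | hh
  · have h1 := (M.isSucc_closing hh).lab_eq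
    rw [M.turn_inl_of_up hh, closingPerm_inl, closingPerm_inl, M.closing_of_le (h := h) (by omega)]
    exact h1
  · rw [M.turn_inl_of_eq hh, closingPerm_inl, closingPerm_inr, M.closing_of_le (by omega)]
    simp [quadLab, M.lab_φ, hh]
  · have h1 := (M.isSucc_closing (h := M.α h) (by rw [M.α_invol]; omega)).lab_eq
    rw [M.α_invol, M.lab_φ, M.α_invol] at h1
    rw [M.turn_inl_of_down (by omega), closingPerm_inl, closingPerm_inr]
    change M.lab (M.α h) - 1 = M.lab (M.closing h) - 1
    omega
  · rw [M.turn_inr_of_up hh, closingPerm_inr, closingPerm_inr]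
    simp [quadLab, hh]
  all_goals
    rw [M.turn_inr_of_le (by omega), closingPerm_inr, closingPerm_inl,
      M.closing_of_le (by rw [M.α_invol]; omega)]
    simp [quadLab, M.lab_φ, M.α_invol]

/-- The quadrangulation made of one edge from each corner of `M` to its successor. -/
noncomputable def quad [Finite H] (hα : ∀ h, M.α h ≠ h) : LabeledQuad (H ⊕ H) where
  σ := M.faceTurn.symm.trans (Equiv.sumComm H H)
  α := Equiv.sumComm H H
  φ := M.faceTurn
  φ_α_σ e := by simp
  α_invol e := by simp
  lab := M.quadLab
  lab_σ e := by
    have := M.quadLab_faceTurn (M.faceTurn.symm e)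
    rw [Equiv.apply_symm_apply] at this
    exact this.symm
  lab_α e := by rcases e with h | h <;> simp [quadLab]
  φ_four e := by
    obtain ⟨x, rfl⟩ := M.closingPerm.surjective e
    simp only [faceTurn_closingPerm, turn_four]
  φ_two_ne e := by
    obtain ⟨x, rfl⟩ := M.closingPerm.surjective e
    simp only [faceTurn_closingPerm]
    exact fun h => M.turn_two_ne hα x (M.closingPerm.injective h)

theorem dec_quad_inl [Finite H] (hα : ∀ h, M.α h ≠ h) (h : H) :
    (M.quad hα).Dec (Sum.inl h) := rfl

theorem not_dec_quad_inr [Finite H] (hα : ∀ h, M.α h ≠ h) (h : H) :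
    ¬ (M.quad hα).Dec (Sum.inr h) := by
  change ¬ M.lab h = M.lab h - 1 - 1
  omega

theorem leads_quad [Finite H] (hα : ∀ h, M.α h ≠ h) {g g' : H} (hg : M.IsSucc g g') :
    (M.quad hα).Leads (Sum.inl g) (Sum.inl g') := by
  obtain ⟨u, n, hn, hl⟩ : ∃ u n, M.φ^[n] u = g ∧ M.lab u = M.lab g - 1 :=
    ⟨g', hg.sameCycle.symm.exists_iterate_eq.imp fun _ hn => ⟨hn, hg.lab_eq⟩⟩
  induction n using Nat.strong_induction_on generalizing g with
  | _ n ih =>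
  have step : ∀ h, M.faceTurn (Sum.inl g) = Sum.inr h →
      (M.quad hα).Leads (Sum.inl h) (Sum.inl g') → (M.quad hα).Leads (Sum.inl g) (Sum.inl g') := by
    rintro h hh ⟨hd, r, hr, hr'⟩
    refine ⟨hd, r + 1, ?_, fun j hj => ?_⟩
    · rw [Function.iterate_succ_apply', hr]
      exact (congrArg _ hh.symm).trans ((M.quad hα).σ_φ (Sum.inl g))
    · rcases Nat.lt_succ_iff_lt_or_eq.1 hj with hj | rfl
      · exact hr' j hj
      · rw [hr]
        exact M.not_dec_quad_inr hα h
  obtain ⟨h, rfl⟩ : ∃ h, M.closing h = g :=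
    (Finite.injective_iff_bijective.1 M.closing_injective).2 g
  have hface : M.faceTurn (Sum.inl (M.closing h)) = M.closingPerm (M.turn (Sum.inl h)) :=
    M.faceTurn_closingPerm (Sum.inl h)
  rcases M.lab_α_cases h with hh | hh | hh
  · rw [M.turn_inl_of_up hh, closingPerm_inl] at hface
    have h1 := M.isSucc_closing hh
    rw [← M.closing_of_le (by omega)] at h1
    rw [h1.unique hg] at hface
    exact ⟨M.dec_quad_inl hα _, 0, by
      exact (congrArg _ hface.symm).trans ((M.quad hα).σ_φ _), by simp⟩
  · rw [M.turn_inl_of_eq hh, closingPerm_inr] at hface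
    have hl' : M.lab (M.φ h) = M.lab h := by rw [M.lab_φ, hh]
    rw [M.closing_of_le hh.ge] at hn hl hg
    refine step h hface ?_
    rcases n with _ | n
    · obtain rfl : u = M.φ h := hn
      omega
    · rw [Function.iterate_succ_apply'] at hn
      exact ih n (by omega) (hg.cons hl') (M.φ.injective hn) (by omega)
  · rw [M.turn_inl_of_down (by omega), closingPerm_inr] at hface
    refine step _ hface ?_
    have hup : M.lab (M.α (M.α h)) = M.lab (M.α h) + 1 := by rw [M.α_invol]; omega
    have h1 := M.isSucc_closing hup
    rw [M.α_invol] at h1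
    have hup' : M.lab (M.φ (M.α h)) = M.lab (M.α h) + 1 := by rw [M.lab_φ, hup]
    obtain ⟨r, hr⟩ := id h1
    have hle : r + 2 ≤ n := by
      by_contra hlt
      have h2 : M.φ^[n] u = M.φ^[n] (M.φ^[r + 2 - n] (M.α h)) := by
        rw [hn, ← Function.iterate_add_apply, show n + (r + 2 - n) = r + 2 by omega]
        exact hr.1.symm
      have h3 := M.φ.injective.iterate _ h2
      have h4 := h1.lab_eq
      rcases h5 : r + 2 - n with _ | p
      · rw [h5] at h3
        obtain rfl : u = M.α h := h3
        omega
      · rw [h5] at h3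
        have h6 : u = M.φ^[p] (M.φ (M.α h)) := h3
        rcases Nat.lt_or_ge r p with hp | hp
        · obtain rfl : p = r + 1 := by omega
          rw [hr.1] at h6
          subst h6
          omega
        · have := hr.2.2 p hp
          rw [← h6] at this
          omega
    obtain ⟨p, rfl⟩ := Nat.exists_eq_add_of_le' hle
    refine ih p (by omega) (h1.append hup' hg) ?_ ?_
    · refine M.φ.injective.iterate (r + 2) ?_
      rw [← Function.iterate_add_apply, Nat.add_comm, hn]
      exact hr.1.symm
    · have := h1.lab_eq
      omega

theorem isDrawing_quad [Finite H] (hα : ∀ h, M.α h ≠ h) :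
    IsDrawing (M.quad hα) M Sum.inl where
  inj := Sum.inl_injective
  dec_iff e := by
    rcases e with h | h
    · simp [M.dec_quad_inl hα h]
    · simp [M.not_dec_quad_inr hα h]
  lab _ := rfl
  swap h := by
    change M.faceTurn (Sum.inr h) = Sum.inr (M.α h) ∨
      M.faceTurn (M.faceTurn (Sum.inr h)) = Sum.inr (M.α h) ∨
      M.faceTurn (M.faceTurn (M.faceTurn (Sum.inr h))) = Sum.inr (M.α h)
    rw [← M.closingPerm_inr h]
    simp only [faceTurn_closingPerm]
    rcases M.lab_α_cases h with hh | hh | hh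
    · left
      rw [M.turn_inr_of_up hh, closingPerm_inr]
    · right; left
      rw [M.turn_inr_of_le hh.le, M.turn_inl_of_eq (by rw [M.α_invol, hh]), closingPerm_inr]
    · right; right
      rw [M.turn_inr_of_le (by omega), M.turn_inl_of_up (by rw [M.α_invol]; omega), M.α_invol,
        M.turn_inl_of_down (by omega), closingPerm_inr]
  next h := by
    have hface := M.faceTurn_closingPerm (Sum.inr (M.σ h))
    rw [closingPerm_inr] at hface
    have hφα : M.φ (M.α (M.σ h)) = h := M.φ_α_σ h
    have hσ := (M.quad hα).σ_φ (Sum.inr (M.σ h))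
    change (M.quad hα).σ (M.faceTurn (Sum.inr (M.σ h))) = Sum.inl (M.σ h) at hσ
    rcases M.lab_α_cases (M.σ h) with hh | hh | hh
    · rw [M.turn_inr_of_up hh, closingPerm_inr] at hface
      have h1 : M.IsSucc (M.α (M.σ h)) (M.φ (M.α (M.σ h))) :=
        isSucc_φ (by rw [hφα, ← M.lab_σ h]; omega)
      rw [hφα] at h1
      obtain ⟨-, n, hn, hn'⟩ := M.leads_quad hα h1
      refine ⟨n + 1, ?_, fun j hj => ?_⟩
      · rw [Function.iterate_succ_apply', hn, ← hσ, hface]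
        rfl
      · rcases Nat.lt_succ_iff_lt_or_eq.1 hj with hj | rfl
        · exact hn' j hj
        · rw [hn]
          exact M.not_dec_quad_inr hα _
    all_goals
      rw [M.turn_inr_of_le (by omega), closingPerm_inl, M.closing_of_le (by rw [M.α_invol]; omega),
        hφα] at hface
      exact ⟨0, by rw [← hσ, hface]; rfl, by simp⟩

end LabeledRotation

/-! ### Cycles of permutations and counting -/

namespace Equiv.Perm

variable {X : Type} [Finite X] (f : Equiv.Perm X)

theorem card_sameCycle_fiber (x : X) :
    Nat.card {y : X // (Quotient.mk (SameCycle.setoid f) y) = Quotient.mk (SameCycle.setoid f) x} =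
      Function.minimalPeriod f x := by
  classical
  have := Fintype.ofFinite X
  have h := MulAction.minimalPeriod_eq_card (a := f) (b := x)
  rw [← Nat.card_eq_fintype_card] at h
  refine (Nat.card_congr (Equiv.subtypeEquivRight fun y => ?_)).trans h.symm
  rw [Quotient.eq, MulAction.mem_orbit_iff]
  constructor
  · rintro hs
    obtain ⟨n, hn⟩ := SameCycle.symm hs
    exact ⟨⟨f ^ n, n, rfl⟩, hn⟩
  · rintro ⟨⟨g, n, rfl⟩, hg⟩
    exact SameCycle.symm ⟨n, hg⟩

theorem card_quotient_mul (n : ℕ) (hn : ∀ x, Function.minimalPeriod f x = n) :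
    Nat.card (Quotient (SameCycle.setoid f)) * n = Nat.card X := by
  classical
  have := Fintype.ofFinite X
  have := Fintype.ofFinite (Quotient (SameCycle.setoid f))
  rw [← Nat.card_congr (Equiv.sigmaFiberEquiv (Quotient.mk (SameCycle.setoid f))), Nat.card_sigma]
  have h : ∀ q : Quotient (SameCycle.setoid f),
      Nat.card {x // Quotient.mk (SameCycle.setoid f) x = q} = n := by
    rintro ⟨x⟩
    exact (f.card_sameCycle_fiber x).trans (hn x)
  rw [Finset.sum_congr rfl fun q _ => h q, Finset.sum_const, Finset.card_univ,
    ← Nat.card_eq_fintype_card, smul_eq_mul]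

end Equiv.Perm

namespace Fatgraph

variable (m : Fatgraph)

instance : Finite m.E := m.finite
instance : Finite m.Vertex := Quotient.finite _

theorem src_surjective (v : m.Vertex) : ∃ e, m.src e = v := Quotient.exists_rep v

theorem face_surjective (v : m.Face) : ∃ e, m.face e = v := Quotient.exists_rep v

theorem src_eq_iff {e e' : m.E} : m.src e = m.src e' ↔ m.σ.SameCycle e e' := Quotient.eq

theorem face_eq_iff {e e' : m.E} : m.face e = m.face e' ↔ m.φ.SameCycle e e' := Quotient.eq

theorem src_σ (e : m.E) : m.src (m.σ e) = m.src e :=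
  (m.src_eq_iff).2 (Equiv.Perm.SameCycle.refl m.σ e).apply_left

theorem src_iterate_σ (n : ℕ) (e : m.E) : m.src (m.σ^[n] e) = m.src e :=
  (m.src_eq_iff).2 (Equiv.Perm.sameCycle_iterate _ _ _).symm

theorem tgt_α (e : m.E) : m.tgt (m.α e) = m.src e := by
  rw [tgt, m.α_invol]

/-- The underlying rotation system of a map. -/
def rotation : RotationSystem m.E where
  σ := m.σ
  α := m.α
  φ := m.φ
  φ_α_σ e := by simpa using congrArg (fun f : Equiv.Perm m.E => f e) m.φ_α_σ
  α_invol := m.α_invol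

theorem φ_α_σ_apply (e : m.E) : m.φ (m.α (m.σ e)) = e := m.rotation.φ_α_σ e

theorem σ_φ (e : m.E) : m.σ (m.φ e) = m.α e := m.rotation.σ_φ e

theorem connected (P : m.E → Prop) (hσ : ∀ e, P e → P (m.σ e)) (hα : ∀ e, P e → P (m.α e))
    (e e' : m.E) (hP : P e) : P e' := by
  have hit : ∀ n e, P e → P (m.σ^[n] e) := fun n e he => by
    induction n with
    | zero => exact he
    | succ n ih =>
      rw [Function.iterate_succ_apply']
      exact hσ _ ih
  have hσ' : ∀ e, P e ↔ P (m.σ e) := fun e => by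
    refine ⟨hσ e, fun h => ?_⟩
    obtain ⟨n, hn⟩ := ((Equiv.Perm.SameCycle.refl m.σ e).apply_left).exists_iterate_eq
    exact hn ▸ hit n _ h
  have hα' : ∀ e, P e ↔ P (m.α e) := fun e =>
    ⟨hα e, fun h => by simpa [m.α_invol] using hα _ h⟩
  have hφ' : ∀ e, P e ↔ P (m.φ e) := fun e => by rw [hσ' (m.φ e), m.σ_φ, ← hα']
  obtain ⟨π, hπ, rfl⟩ := m.transitive e e'
  suffices h : ∀ e, P e ↔ P (π e) from (h e).1 hP
  induction hπ using Subgroup.closure_induction with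
  | mem x hx =>
    rcases hx with rfl | rfl | rfl
    · exact hσ'
    · exact hα'
    · exact hφ'
  | one => exact fun _ => Iff.rfl
  | mul x y _ _ hx hy => exact fun e => (hy e).trans (hx _)
  | inv x _ hx => exact fun e => by simpa using (hx (x⁻¹ e)).symm

/-- A connected rotation system is a map. -/
def ofRotation {E : Type} [Finite E] [Nonempty E] (m : RotationSystem E) (hα : ∀ e, m.α e ≠ e)
    (hc : ∀ P : E → Prop, (∀ e, P (m.σ e) ↔ P e) → (∀ e, P (m.α e) ↔ P e) → ∀ e e', P e → P e') :
    Fatgraph where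
  E := E
  finite := inferInstance
  nonempty := inferInstance
  σ := m.σ
  α := m.α
  φ := m.φ
  φ_α_σ := Equiv.ext m.φ_α_σ
  α_invol := m.α_invol
  α_ne := hα
  transitive e e' := by
    have hinv : ∀ f ∈ ({m.σ, m.α, m.φ} : Set (Equiv.Perm E)), ∀ e'',
        (∃ π ∈ Subgroup.closure {m.σ, m.α, m.φ}, π e = f e'') ↔
        ∃ π ∈ Subgroup.closure {m.σ, m.α, m.φ}, π e = e'' := by
      intro f hf e''
      have hf' := Subgroup.subset_closure hf
      constructor
      · rintro ⟨π, hπ, h⟩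
        exact ⟨f⁻¹ * π, mul_mem (inv_mem hf') hπ, by simp [h]⟩
      · rintro ⟨π, hπ, h⟩
        exact ⟨f * π, mul_mem hf' hπ, by simp [h]⟩
    exact hc (fun e' => ∃ π ∈ Subgroup.closure {m.σ, m.α, m.φ}, π e = e')
      (hinv m.σ (by simp)) (hinv m.α (by simp)) e e' ⟨1, one_mem _, rfl⟩

theorem minimalPeriod_α (e : m.E) : Function.minimalPeriod m.α e = 2 :=
  Function.minimalPeriod_eq_prime (p := 2) (m.α_invol e) (m.α_ne e)

theorem card_edge : Nat.card m.Edge * 2 = Nat.card m.E :=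
  m.α.card_quotient_mul 2 m.minimalPeriod_α

theorem isQuadrangulation_iff :
    m.IsQuadrangulation ↔ ∀ e, Function.minimalPeriod m.φ e = 4 := by
  constructor
  · intro h e
    rw [← Equiv.Perm.card_sameCycle_fiber]
    exact h (m.face e)
  · intro h f
    obtain ⟨e, rfl⟩ := m.face_surjective f
    rw [← h e, ← Equiv.Perm.card_sameCycle_fiber]
    rfl

theorem isQuadrangulation_iff_φ :
    m.IsQuadrangulation ↔
      ∀ e, m.φ (m.φ (m.φ (m.φ e))) = e ∧ m.φ (m.φ e) ≠ e := by
  rw [isQuadrangulation_iff]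
  refine forall_congr' fun e => ⟨fun h => ?_, fun ⟨h4, h2⟩ => ?_⟩
  · refine ⟨?_, fun h2 => ?_⟩
    · have := Function.isPeriodicPt_minimalPeriod m.φ e
      rw [h] at this
      exact this
    · have := Function.IsPeriodicPt.minimalPeriod_le (f := m.φ) (x := e) (n := 2) (by norm_num) h2
      omega
  · have h4' : Function.IsPeriodicPt m.φ (2 ^ (1 + 1)) e := h4
    have := Function.minimalPeriod_eq_prime_pow (p := 2) (f := m.φ) (x := e) (k := 1)
      (show ¬ Function.IsPeriodicPt m.φ (2 ^ 1) e from h2) h4'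
    simpa using this

theorem card_face_of_isQuadrangulation (h : m.IsQuadrangulation) :
    Nat.card m.Face * 4 = Nat.card m.E :=
  m.φ.card_quotient_mul 4 (m.isQuadrangulation_iff.1 h)

/-! #### The graph distance -/

theorem adj_iff {v w : m.Vertex} :
    m.graph.Adj v w ↔ v ≠ w ∧ ∃ e, m.src e = v ∧ m.tgt e = w := by
  rw [graph, SimpleGraph.fromRel_adj]
  refine and_congr_right fun _ => ⟨?_, Or.inl⟩
  rintro (h | ⟨e, h1, h2⟩)
  · exact h
  · exact ⟨m.α e, h2, (m.tgt_α e).trans h1⟩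

theorem graph_connected : m.graph.Connected := by
  have : Nonempty m.Vertex := m.nonempty.map m.src
  refine SimpleGraph.Connected.mk fun v w => ?_
  obtain ⟨e, rfl⟩ := m.src_surjective v
  obtain ⟨e', rfl⟩ := m.src_surjective w
  refine m.connected (fun e' => m.graph.Reachable (m.src e) (m.src e')) (fun e' h => ?_)
    (fun e' h => ?_) e e' (SimpleGraph.Reachable.refl _)
  · rwa [m.src_σ]
  · by_cases heq : m.src e' = m.tgt e'
    · exact (show m.src e' = m.src (m.α e') from heq) ▸ h
    · exact h.trans (m.adj_iff.2 ⟨heq, e', rfl, rfl⟩).reachable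

theorem dist_self (v : m.Vertex) : m.dist v v = 0 := SimpleGraph.dist_self

theorem dist_comm (v w : m.Vertex) : m.dist v w = m.dist w v := SimpleGraph.dist_comm

theorem dist_src_le (e : m.E) (w : m.Vertex) : m.dist (m.src e) w ≤ m.dist (m.tgt e) w + 1 := by
  by_cases heq : m.src e = m.tgt e
  · rw [heq]
    omega
  · have h1 := m.graph_connected.dist_triangle (u := m.src e) (v := m.tgt e) (w := w)
    have h2 := SimpleGraph.dist_eq_one_iff_adj.2 (m.adj_iff.2 ⟨heq, e, rfl, rfl⟩)
    unfold dist
    omega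

/-- The first step of a geodesic. -/
theorem exists_dist_tgt_add_one {v w : m.Vertex} (h : v ≠ w) :
    ∃ e, m.src e = v ∧ m.dist (m.tgt e) w + 1 = m.dist v w := by
  obtain ⟨p, hp⟩ := m.graph_connected.exists_walk_length_eq_dist v w
  cases p with
  | nil => exact absurd rfl h
  | cons hadj q =>
    obtain ⟨-, e, rfl, rfl⟩ := m.adj_iff.1 hadj
    refine ⟨e, rfl, ?_⟩
    have h1 := SimpleGraph.dist_le q
    have h2 := m.dist_src_le e w
    rw [SimpleGraph.Walk.length_cons] at hp
    unfold dist at *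
    omega

theorem dist_induction {w : m.Vertex} {P : m.Vertex → ℕ → Prop} (base : P w 0)
    (step : ∀ e n, P (m.tgt e) n → P (m.src e) (n + 1)) (v : m.Vertex) : P v (m.dist v w) := by
  generalize hn : m.dist v w = n
  induction n generalizing v with
  | zero =>
    have : v = w := m.graph_connected.dist_eq_zero_iff.1 hn
    exact this ▸ base
  | succ n ih =>
    obtain ⟨e, rfl, he⟩ := m.exists_dist_tgt_add_one (v := v) (w := w) (by
      rintro rfl
      rw [m.dist_self] at hn
      omega)
    exact step e n (ih _ (by omega))

theorem sub_le_dist (L : m.Vertex → ℤ) (hL : ∀ e, L (m.src e) ≤ L (m.tgt e) + 1)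
    (v w : m.Vertex) : L v - L w ≤ m.dist v w := by
  refine m.dist_induction (P := fun v n => L v - L w ≤ n) (by simp) (fun e n h => ?_) v
  have := hL e
  push_cast
  omega

theorem dist_parity (L : m.Vertex → ℤ)
    (hL : ∀ e, L (m.tgt e) = L (m.src e) + 1 ∨ L (m.tgt e) = L (m.src e) - 1) (v w : m.Vertex) :
    ∃ r : ℤ, (m.dist v w : ℤ) = L v - L w + 2 * r := by
  refine m.dist_induction (P := fun v n => ∃ r : ℤ, (n : ℤ) = L v - L w + 2 * r) ⟨0, by simp⟩
    (fun e n h => ?_) v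
  obtain ⟨r, hr⟩ := h
  push_cast
  rcases hL e with h | h
  · exact ⟨r + 1, by omega⟩
  · exact ⟨r, by omega⟩

end Fatgraph

/-! ### Labels and delays -/

namespace DelayedQuad

variable {g k : ℕ} (Q : DelayedQuad g k)

theorem label_le (v : Q.Vertex) (i : Fin k) : Q.label v ≤ Q.d i + Q.dist v (Q.x i) :=
  ciInf_le (Set.finite_range _).bddBelow i

theorem x_injective : Function.Injective Q.x := fun i j hij => by
  by_contra hne
  have h1 := Q.delay_lt i j hne
  rw [hij, Q.dist_self] at h1
  have := abs_nonneg (Q.d i - Q.d j)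
  push_cast at h1
  omega

variable [NeZero k]

theorem exists_label_eq (v : Q.Vertex) : ∃ i, Q.label v = Q.d i + Q.dist v (Q.x i) := by
  obtain ⟨i, hi⟩ := exists_eq_ciInf_of_finite
    (f := fun i : Fin k => Q.d i + (Q.dist v (Q.x i) : ℤ))
  exact ⟨i, hi.symm⟩

theorem label_x (i : Fin k) : Q.label (Q.x i) = Q.d i := by
  refine le_antisymm ?_ ?_
  · have := Q.label_le (Q.x i) i
    simpa [Fatgraph.dist_self] using this
  · obtain ⟨j, hj⟩ := Q.exists_label_eq (Q.x i)
    rcases eq_or_ne i j with rfl | hij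
    · rw [hj]
      omega
    · have := abs_lt.1 (Q.delay_lt i j hij)
      omega

theorem label_src_le (e : Q.E) : Q.label (Q.src e) ≤ Q.label (Q.tgt e) + 1 := by
  obtain ⟨i, hi⟩ := Q.exists_label_eq (Q.tgt e)
  have h1 := Q.label_le (Q.src e) i
  have h2 := Q.dist_src_le e (Q.x i)
  omega

theorem label_tgt (e : Q.E) :
    Q.label (Q.tgt e) = Q.label (Q.src e) + 1 ∨ Q.label (Q.tgt e) = Q.label (Q.src e) - 1 := by
  have h1 := Q.label_src_le e
  have h2 := Q.label_src_le (Q.α e)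
  rw [Q.tgt_α] at h2
  change Q.label (Q.tgt e) ≤ _ at h2
  obtain ⟨c, hc⟩ := Q.bip
  let L : Q.Vertex → ℤ := fun v => if c v then 1 else 0
  have hL : ∀ e, L (Q.tgt e) = L (Q.src e) + 1 ∨ L (Q.tgt e) = L (Q.src e) - 1 := fun e => by
    have := hc e
    simp only [L]
    revert this
    cases c (Q.src e) <;> cases c (Q.tgt e) <;> simp
  obtain ⟨i, hi⟩ := Q.exists_label_eq (Q.src e)
  obtain ⟨j, hj⟩ := Q.exists_label_eq (Q.tgt e)
  obtain ⟨r, hr⟩ := Q.dist_parity L hL (Q.src e) (Q.x i)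
  obtain ⟨s, hs⟩ := Q.dist_parity L hL (Q.tgt e) (Q.x j)
  obtain ⟨t, ht⟩ := Q.dist_parity L hL (Q.x i) (Q.x j)
  obtain ⟨n, hn⟩ := Q.delay_even i j
  have := hL e
  omega

/-- The labeled quadrangulation given by a quadrangulation with delays, the labels being shifted
by a constant. -/
noncomputable def labeledQuad (a : ℤ) : LabeledQuad Q.E where
  toRotationSystem := Q.rotation
  lab e := Q.elabel e + a
  lab_σ e := by
    change Q.label (Q.src (Q.σ e)) + a = Q.label (Q.src e) + a
    rw [Q.src_σ]
  lab_α e := by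
    change Q.label (Q.tgt e) + a = Q.label (Q.src e) + a + 1 ∨
      Q.label (Q.tgt e) + a = Q.label (Q.src e) + a - 1
    have := Q.label_tgt e
    omega
  φ_four e := ((Q.isQuadrangulation_iff_φ.1 Q.quad) e).1
  φ_two_ne e := ((Q.isQuadrangulation_iff_φ.1 Q.quad) e).2

theorem dec_labeledQuad_iff (a : ℤ) (e : Q.E) :
    (Q.labeledQuad a).Dec e ↔ Q.label (Q.tgt e) = Q.label (Q.src e) - 1 := by
  change Q.label (Q.tgt e) + a = Q.label (Q.src e) + a - 1 ↔ _
  omega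

/-- The sources are the local minima of the labels. -/
theorem exists_eq_x_iff (a : ℤ) (v : Q.Vertex) :
    (∃ i, v = Q.x i) ↔ ∀ e, Q.src e = v → ¬ (Q.labeledQuad a).Dec e := by
  constructor
  · rintro ⟨i, rfl⟩ e he hd
    rw [dec_labeledQuad_iff, he, label_x] at hd
    obtain ⟨j, hj⟩ := Q.exists_label_eq (Q.tgt e)
    have h1 := Q.dist_src_le e (Q.x j)
    rw [he] at h1
    rcases eq_or_ne i j with rfl | hij
    · omega
    · have := abs_lt.1 (Q.delay_lt i j hij)
      omega
  · intro h
    obtain ⟨i, hi⟩ := Q.exists_label_eq v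
    refine ⟨i, ?_⟩
    by_contra hne
    obtain ⟨e, rfl, he⟩ := Q.exists_dist_tgt_add_one hne
    refine h e rfl ?_
    rw [dec_labeledQuad_iff]
    have h1 := Q.label_le (Q.tgt e) i
    have h2 := Q.label_src_le e
    omega

end DelayedQuad

/-- The local minima of a labeling determine it. -/
theorem Fatgraph.exists_eq_add_dist (m : Fatgraph) {k : ℕ} (L : m.Vertex → ℤ)
    (hL : ∀ e, L (m.tgt e) = L (m.src e) + 1 ∨ L (m.tgt e) = L (m.src e) - 1)
    (x : Fin k → m.Vertex) (hx : ∀ v, (∀ e, m.src e = v → L (m.tgt e) ≠ L v - 1) → ∃ i, v = x i)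
    (v : m.Vertex) : ∃ i, L v = L (x i) + m.dist v (x i) := by
  obtain ⟨v₀, hv₀⟩ := @Finite.exists_min _ _ _ ⟨v⟩ _ L
  obtain ⟨n, hn⟩ : ∃ n : ℕ, L v = L v₀ + n := ⟨(L v - L v₀).toNat, by have := hv₀ v; omega⟩
  induction n generalizing v with
  | zero =>
    obtain ⟨i, rfl⟩ := hx v fun e _ h => by
      have := hv₀ (m.tgt e)
      push_cast at hn
      omega
    exact ⟨i, by simp [m.dist_self]⟩
  | succ n ih =>
    by_cases hd : ∀ e, m.src e = v → L (m.tgt e) ≠ L v - 1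
    · obtain ⟨i, rfl⟩ := hx v hd
      exact ⟨i, by simp [m.dist_self]⟩
    · push Not at hd
      obtain ⟨e, rfl, he⟩ := hd
      obtain ⟨i, hi⟩ := ih (m.tgt e) (by push_cast at hn; omega)
      refine ⟨i, ?_⟩
      have h1 := m.sub_le_dist L (fun e => by have := hL e; omega) (m.src e) (x i)
      have h2 := m.dist_src_le e (x i)
      omega

/-- A labeled quadrangulation with indexed local minima is a quadrangulation with delays. -/
def DelayedQuad.ofLabels {g k : ℕ} (m : Fatgraph) (genus : m.HasGenus g)
    (quad : m.IsQuadrangulation) (L : m.Vertex → ℤ)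
    (hL : ∀ e, L (m.tgt e) = L (m.src e) + 1 ∨ L (m.tgt e) = L (m.src e) - 1)
    (x : Fin k → m.Vertex) (inj : Function.Injective x)
    (hx : ∀ i e, m.src e = x i → L (m.tgt e) ≠ L (x i) - 1) : DelayedQuad g k where
  toFatgraph := m
  genus := genus
  quad := quad
  bip := ⟨fun v => decide (Even (L v)), fun e => by
    have := hL e
    rw [ne_eq, decide_eq_decide, Int.even_iff, Int.even_iff]
    omega⟩
  x := x
  d i := L (x i)
  delay_lt i j hij := by
    have key : ∀ i j, i ≠ j → L (x i) - L (x j) < m.dist (x i) (x j) := fun i j hij => by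
      have h1 := m.sub_le_dist L (fun e => by have := hL e; omega) (x i) (x j)
      refine lt_of_le_of_ne h1 fun heq => ?_
      obtain ⟨e, he, he'⟩ := m.exists_dist_tgt_add_one (inj.ne hij)
      have h2 := m.sub_le_dist L (fun e => by have := hL e; omega) (m.tgt e) (x j)
      have h3 := hL e
      have h4 := hx i e he
      rw [he] at h3
      omega
    have h1 := key i j hij
    have h2 := key j i hij.symm
    rw [m.dist_comm] at h2
    rw [abs_lt]
    constructor <;> omega
  delay_even i j := by
    obtain ⟨r, hr⟩ := m.dist_parity L hL (x i) (x j)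
    have h1 := m.sub_le_dist L (fun e => by have := hL e; omega) (x j) (x i)
    rw [m.dist_comm] at h1
    exact ⟨(L (x i) - L (x j) + r).toNat, by omega⟩

theorem DelayedQuad.label_ofLabels {g k : ℕ} [NeZero k] (m : Fatgraph) (genus : m.HasGenus g)
    (quad : m.IsQuadrangulation) (L : m.Vertex → ℤ)
    (hL : ∀ e, L (m.tgt e) = L (m.src e) + 1 ∨ L (m.tgt e) = L (m.src e) - 1)
    (x : Fin k → m.Vertex) (inj : Function.Injective x)
    (hx : ∀ i e, m.src e = x i → L (m.tgt e) ≠ L (x i) - 1)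
    (hx' : ∀ v, (∀ e, m.src e = v → L (m.tgt e) ≠ L v - 1) → ∃ i, v = x i) (v : m.Vertex) :
    (DelayedQuad.ofLabels m genus quad L hL x inj hx).label v = L v := by
  let Q := DelayedQuad.ofLabels m genus quad L hL x inj hx
  refine le_antisymm ?_ ?_
  · obtain ⟨i, hi⟩ := m.exists_eq_add_dist L hL x hx' v
    rw [hi]
    exact Q.label_le v i
  · obtain ⟨i, hi⟩ := Q.exists_label_eq v
    have h1 := m.sub_le_dist L (fun e => by have := hL e; omega) v (x i)
    change Q.label v = L (x i) + m.dist v (x i) at hi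
    change L v ≤ Q.label v
    omega

/-! ### Genus and faces of the map drawn on a quadrangulation -/

section

variable {q m : Fatgraph} {Q : LabeledQuad q.E} {M : LabeledRotation m.E} {ε : m.E → q.E}

theorem IsDrawing.src_eq_iff (D : IsDrawing Q M ε) (hQ : Q.toRotationSystem = q.rotation)
    (hM : M.toRotationSystem = m.rotation) (h h' : m.E) :
    q.src (ε h) = q.src (ε h') ↔ m.src h = m.src h' := by
  have hσ : Q.σ = q.σ := congrArg RotationSystem.σ hQ
  have hσ' : M.σ = m.σ := congrArg RotationSystem.σ hM
  rw [q.src_eq_iff, m.src_eq_iff, ← hσ, ← hσ', D.sameCycle_ε_iff]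

theorem IsDrawing.hasGenus_iff (D : IsDrawing Q M ε) (hQ : Q.toRotationSystem = q.rotation)
    (hM : M.toRotationSystem = m.rotation) {k : ℕ} {x : Fin k → q.Vertex}
    (inj : Function.Injective x)
    (hx : ∀ v, (∃ i, v = x i) ↔ ∀ e, q.src e = v → ¬ Q.Dec e)
    (hquad : q.IsQuadrangulation) (hF : Nat.card m.Face = k) (g : ℕ) :
    q.HasGenus g ↔ m.HasGenus g := by
  have hE : Nat.card q.E = Nat.card m.E + Nat.card m.E := by
    rw [← Nat.card_sum]
    exact (Nat.card_congr (Equiv.ofBijective _ D.bijective_elim)).symm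
  have hV : Nat.card q.Vertex = Nat.card m.Vertex + k := by
    let t : m.Vertex ⊕ Fin k → q.Vertex := Sum.elim
      (Quotient.lift (fun h => q.src (ε h)) fun h h' hs =>
        (D.src_eq_iff hQ hM h h').2 (Quotient.sound hs)) x
    have ht : ∀ h, t (Sum.inl (m.src h)) = q.src (ε h) := fun _ => rfl
    have hbij : Function.Bijective t := by
      refine ⟨?_, fun v => ?_⟩
      · rintro (v | i) (w | j) hvw
        · obtain ⟨h, rfl⟩ := m.src_surjective v
          obtain ⟨h', rfl⟩ := m.src_surjective w
          exact congrArg _ ((D.src_eq_iff hQ hM h h').1 hvw)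
        · obtain ⟨h, rfl⟩ := m.src_surjective v
          exact absurd (D.dec h) ((hx _).1 ⟨j, rfl⟩ _ hvw)
        · obtain ⟨h, rfl⟩ := m.src_surjective w
          exact absurd (D.dec h) ((hx _).1 ⟨i, rfl⟩ _ hvw.symm)
        · exact congrArg _ (inj hvw)
      · by_cases hv : ∃ i, v = x i
        · obtain ⟨i, rfl⟩ := hv
          exact ⟨Sum.inr i, rfl⟩
        · rw [hx] at hv
          push Not at hv
          obtain ⟨e, rfl, he⟩ := hv
          obtain ⟨h, rfl⟩ := (D.dec_iff e).1 he
          exact ⟨Sum.inl (m.src h), rfl⟩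
    rw [← Nat.card_congr (Equiv.ofBijective t hbij), Nat.card_sum, Nat.card_fin]
  have h1 := q.card_edge
  have h2 := m.card_edge
  have h3 := q.card_face_of_isQuadrangulation hquad
  unfold Fatgraph.HasGenus
  omega

theorem IsDrawing.isMin_iff_exists (D : IsDrawing Q M ε) (hQ : Q.toRotationSystem = q.rotation)
    {k : ℕ} {x : Fin k → q.Vertex}
    (hx : ∀ v, (∃ i, v = x i) ↔ ∀ e, q.src e = v → ¬ Q.Dec e) (h : m.E) :
    M.IsMin h ↔ ∃ i, q.tgt (ε h) = x i := by
  have hσ : Q.σ = q.σ := congrArg RotationSystem.σ hQ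
  have hα : Q.α = q.α := congrArg RotationSystem.α hQ
  rw [D.isMin_iff, hx]
  refine forall_congr' fun e => ?_
  rw [Fatgraph.tgt, q.src_eq_iff, Equiv.Perm.sameCycle_comm, hσ, hα]

/-- Two half-edges ending at sources end at the same source if and only if they lie in the same
face of the map. -/
theorem IsDrawing.tgt_eq_iff (D : IsDrawing Q M ε) (hQ : Q.toRotationSystem = q.rotation)
    (hM : M.toRotationSystem = m.rotation) {h h' : m.E} (hm : M.IsMin h) (hm' : M.IsMin h') :
    q.tgt (ε h) = q.tgt (ε h') ↔ m.face h = m.face h' := by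
  have hσ : Q.σ = q.σ := congrArg RotationSystem.σ hQ
  have hα : Q.α = q.α := congrArg RotationSystem.α hQ
  have hφ : M.φ = m.φ := congrArg RotationSystem.φ hM
  rw [Fatgraph.tgt, Fatgraph.tgt, q.src_eq_iff, m.face_eq_iff, ← hσ, ← hα, ← hφ]
  refine ⟨fun hs => ?_, fun hs => D.sameCycle_of_isMin hm hm' hs⟩
  obtain ⟨g, hg, -, hs'⟩ := D.exists_of_isMin_of_sameCycle hm hs
  exact D.inj (Q.α.injective hg) ▸ hs'

/-- The faces of the map correspond to the sources. -/
theorem IsDrawing.exists_face_equiv (D : IsDrawing Q M ε) (hQ : Q.toRotationSystem = q.rotation)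
    (hM : M.toRotationSystem = m.rotation) {k : ℕ} {x : Fin k → q.Vertex}
    (inj : Function.Injective x)
    (hx : ∀ v, (∃ i, v = x i) ↔ ∀ e, q.src e = v → ¬ Q.Dec e) :
    ∃ idx : m.Face ≃ Fin k, ∀ h i, q.tgt (ε h) = x i → idx (m.face h) = i := by
  have hα : Q.α = q.α := congrArg RotationSystem.α hQ
  have hφ : M.φ = m.φ := congrArg RotationSystem.φ hM
  have hex : ∀ f : m.Face, ∃ i h, m.face h = f ∧ M.IsMin h ∧ q.tgt (ε h) = x i := fun f => by
    obtain ⟨h, rfl⟩ := m.face_surjective f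
    obtain ⟨h', hs, hm⟩ := M.exists_isMin h
    obtain ⟨i, hi⟩ := (D.isMin_iff_exists hQ hx h').1 hm
    exact ⟨i, h', m.face_eq_iff.2 (hφ ▸ hs.symm), hm, hi⟩
  choose t c hc hmin ht using hex
  have key : ∀ h i, q.tgt (ε h) = x i → t (m.face h) = i := fun h i hi => by
    apply inj
    rw [← ht, ← hi, D.tgt_eq_iff hQ hM (hmin _) ((D.isMin_iff_exists hQ hx h).2 ⟨i, hi⟩), hc]
  refine ⟨Equiv.ofBijective t ⟨fun f f' hf => ?_, fun i => ?_⟩, key⟩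
  · rw [← hc f, ← hc f', ← D.tgt_eq_iff hQ hM (hmin _) (hmin _), ht, ht, hf]
  · obtain ⟨e, he⟩ := q.src_surjective (x i)
    obtain ⟨h, rfl⟩ := D.exists_of_not_dec ((hx _).1 ⟨i, rfl⟩ e he)
    rw [hα] at he
    exact ⟨m.face h, key h i he⟩

end

/-! ### Overlays and drawings -/

namespace LabeledMap

variable {g k : ℕ} (M : LabeledMap g k)

/-- The labeled rotation system that underlies a labeled map. -/
def labeledRotation : LabeledRotation M.E where
  toRotationSystem := M.rotation
  lab := M.elabel
  lab_σ h := congrArg M.lab (M.src_σ h)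
  lab_α h := by
    rw [abs_sub_comm]
    exact M.lab_adj h

theorem isMin_iff (h : M.E) :
    M.labeledRotation.IsMin h ↔ M.elabel h = M.sourceLabel (M.idx (M.face h)) + 1 := by
  let S := {h' : M.E // M.idx (M.face h') = M.idx (M.face h)}
  have hS : Nonempty S := ⟨⟨h, rfl⟩⟩
  have hbdd : BddBelow (Set.range fun h' : S => M.elabel h'.1) := (Set.finite_range _).bddBelow
  have hsl : M.sourceLabel (M.idx (M.face h)) + 1 = ⨅ h' : S, M.elabel h'.1 := by
    simp [sourceLabel, S]
  rw [hsl, LabeledRotation.isMin_iff]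
  constructor
  · intro hm
    refine le_antisymm (le_ciInf fun h' => hm h'.1 ?_) (ciInf_le hbdd ⟨h, rfl⟩)
    exact M.face_eq_iff.1 (M.idx.injective h'.2.symm)
  · intro hm g hg
    change M.elabel h ≤ M.elabel g
    rw [hm]
    exact ciInf_le hbdd ⟨g, congrArg M.idx (M.face_eq_iff.2 hg.symm)⟩

theorem succ_of_isMin {h : M.E} (hm : M.labeledRotation.IsMin h) :
    M.succ h = Sum.inr (M.idx (M.face h)) := by
  rw [succ, if_pos ((M.isMin_iff h).1 hm)]

theorem succ_of_isSucc {h h' : M.E} (hs : M.labeledRotation.IsSucc h h') :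
    M.succ h = Sum.inl h' := by
  rw [succ, if_neg (mt (M.isMin_iff h).2 hs.not_isMin)]
  obtain ⟨n, h1, h2, h3⟩ := hs
  have hleast : IsLeast {n : ℕ | 1 ≤ n ∧ M.elabel ((M.φ ^ n) h) = M.elabel h - 1} (n + 1) := by
    refine ⟨⟨by omega, ?_⟩, fun j hj => ?_⟩
    · rw [← Equiv.Perm.iterate_eq_pow]
      exact (congrArg M.elabel h1).trans h2
    · by_contra hlt
      have h4 : M.elabel h ≤ M.elabel ((M.φ ^ j) h) := h3 j (by omega)
      rw [hj.2] at h4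
      omega
  rw [hleast.csInf_eq]
  exact congrArg _ h1

end LabeledMap

section Overlay

variable {g k : ℕ} [NeZero k] {Q : DelayedQuad g k} {M : LabeledMap g k} {β : M.E → Q.E}

theorem DelayedQuad.added_iff (Q : DelayedQuad g k) (a : ℤ) (i i' : Q.E) :
    Q.Added (Q.φ i) (Q.φ i') ↔ ¬ (Q.labeledQuad a).Dec i ∧ ¬ (Q.labeledQuad a).Dec i' ∧
      (Q.φ i = i' ∨ Q.φ (Q.φ i) = i' ∨ Q.φ (Q.φ (Q.φ i)) = i') := by
  have hl : ∀ e, (Q.labeledQuad a).lab e = Q.elabel e + a := fun _ => rfl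
  have hφ : ∀ e, (Q.labeledQuad a).φ e = Q.φ e := fun _ => rfl
  have hinc : ∀ e, ¬ (Q.labeledQuad a).Dec e ↔ Q.elabel (Q.φ e) = Q.elabel e + 1 := fun e => by
    rw [LabeledQuad.not_dec_iff, hl, hl, hφ]
    omega
  have hc : ∀ e, Q.elabel (Q.φ e) = Q.elabel e + 1 ∨ Q.elabel (Q.φ e) = Q.elabel e - 1 :=
    fun e => by
      have := (Q.labeledQuad a).lab_φ_cases e
      rw [hl, hl, hφ] at this
      omega
  have h4 : ∀ e, Q.φ (Q.φ (Q.φ (Q.φ e))) = e := (Q.labeledQuad a).φ_four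
  rw [hinc, hinc]
  constructor
  · rintro ⟨b, ⟨⟨h1, h2, h3⟩, ⟨hc, hc'⟩ | ⟨hc, hc'⟩⟩ | ⟨⟨h1, h2, h3⟩, hc, hc'⟩⟩
    · obtain rfl := Q.φ.injective hc
      obtain rfl := Q.φ.injective hc'
      exact ⟨by omega, h1, Or.inr (Or.inr (h4 _))⟩
    · obtain rfl := Q.φ.injective hc
      obtain rfl := Q.φ.injective hc'
      exact ⟨h1, by omega, Or.inl rfl⟩
    · obtain rfl := Q.φ.injective hc
      obtain rfl := Q.φ.injective hc'
      exact ⟨h1, by omega, Or.inr (Or.inl rfl)⟩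
  · rintro ⟨h1, h2, h | h | h⟩
    · subst h
      refine ⟨i, Or.inl ⟨⟨h1, by omega, ?_⟩, Or.inr ⟨rfl, rfl⟩⟩⟩
      have h5 := hc (Q.φ (Q.φ (Q.φ i)))
      have h6 := hc (Q.φ (Q.φ i))
      rw [h4] at h5
      omega
    · subst h
      have h5 := hc (Q.φ (Q.φ (Q.φ i)))
      have h6 := hc (Q.φ i)
      rw [h4] at h5
      exact ⟨i, Or.inr ⟨⟨h1, by omega, by omega⟩, rfl, rfl⟩⟩
    · have hi : Q.φ i' = i := by rw [← h, h4]
      subst hi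
      have h5 := hc (Q.φ (Q.φ i'))
      have h6 := hc (Q.φ (Q.φ (Q.φ i')))
      rw [h4] at h6
      exact ⟨i', Or.inl ⟨⟨h2, by omega, by omega⟩, Or.inl ⟨rfl, rfl⟩⟩⟩

theorem DelayedQuad.exists_added_iff (Q : DelayedQuad g k) (a : ℤ) (c : Q.E) :
    (∃ c', Q.Added c c') ↔ (Q.labeledQuad a).Dec (Q.σ c) := by
  have h1 : (Q.labeledQuad a).Dec (Q.σ c) ↔ ¬ (Q.labeledQuad a).Dec (Q.α (Q.σ c)) :=
    ((not_congr ((Q.labeledQuad a).dec_α_iff (Q.σ c))).trans not_not).symm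
  rw [h1]
  constructor
  · rintro ⟨c', hc'⟩
    rw [← Q.φ_α_σ_apply c, ← Q.φ_α_σ_apply c', Q.added_iff a] at hc'
    exact hc'.1
  · intro hd
    refine ⟨Q.φ ((Q.labeledQuad a).partner (Q.α (Q.σ c))), ?_⟩
    conv_lhs => rw [← Q.φ_α_σ_apply c]
    rw [Q.added_iff a]
    exact ⟨hd, (Q.labeledQuad a).not_dec_partner hd, (Q.labeledQuad a).partner_cases _⟩

theorem inCorner_iff (a : ℤ) (hβ : ∀ c, c ∈ Set.range β ↔ (Q.labeledQuad a).Dec (Q.σ c))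
    (h : M.E) (e : Q.E) : InCorner Q M β h e ↔
      ∃ n, Q.σ^[n] (Q.σ (β h)) = e ∧
        ∀ j < n, ¬ (Q.labeledQuad a).Dec (Q.σ^[j + 1] (Q.σ (β h))) := by
  have hmem : ∀ j, (Q.σ ^ (j + 1)) (β h) ∉ Set.range β ↔
      ¬ (Q.labeledQuad a).Dec (Q.σ^[j + 1] (Q.σ (β h))) := fun j => by
    rw [hβ, ← Equiv.Perm.iterate_eq_pow, ← Function.iterate_succ_apply' Q.σ]
    rfl
  constructor
  · rintro ⟨n, hn, rfl, hn'⟩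
    obtain ⟨n, rfl⟩ := Nat.exists_eq_add_of_le' hn
    exact ⟨n, rfl, fun j hj => (hmem j).1 (hn' (j + 1) (by omega) (by omega))⟩
  · rintro ⟨n, rfl, hn'⟩
    refine ⟨n + 1, by omega, rfl, fun j hj hj' => ?_⟩
    obtain ⟨j, rfl⟩ := Nat.exists_eq_add_of_le' hj
    exact (hmem j).2 (hn' j (by omega))

theorem IsOverlay.mem_range_iff (O : IsOverlay Q M β) (a : ℤ) (c : Q.E) :
    c ∈ Set.range β ↔ (Q.labeledQuad a).Dec (Q.σ c) := by
  rw [← Q.exists_added_iff]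
  constructor
  · rintro ⟨h, rfl⟩
    exact ⟨β (M.α h), (O.edges _ _).1 ⟨h, rfl, rfl⟩⟩
  · rintro ⟨c', hc'⟩
    obtain ⟨h, rfl, -⟩ := (O.edges _ _).2 hc'
    exact ⟨h, rfl⟩

theorem IsOverlay.exists_isDrawing (O : IsOverlay Q M β) :
    ∃ a, IsDrawing (Q.labeledQuad a) M.labeledRotation fun h => Q.σ (β h) := by
  obtain ⟨a, ha⟩ := O.labels
  refine ⟨a, fun h h' hh => O.inj (Q.σ.injective hh), fun e => ?_, fun h => ?_, fun h => ?_,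
    fun h => ?_⟩
  · rw [← Q.σ.apply_symm_apply e, ← O.mem_range_iff a]
    simp only [EmbeddingLike.apply_eq_iff_eq]
    rfl
  · change M.elabel h = Q.label (Q.src (Q.σ (β h))) + a
    rw [Q.src_σ, ha]
    rfl
  · have h1 := (O.edges _ _).1 ⟨h, rfl, rfl⟩
    rw [← Q.φ_α_σ_apply (β h), ← Q.φ_α_σ_apply (β (M.α h)), Q.added_iff a] at h1
    exact h1.2.2
  · obtain ⟨n, hn, hn'⟩ := (inCorner_iff a (O.mem_range_iff a) h _).1 (O.next h)
    refine ⟨n, ?_, hn'⟩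
    exact (Function.iterate_succ_apply' _ _ _).trans (congrArg Q.σ hn)

theorem IsDrawing.isOverlay {a : ℤ} {ε : M.E → Q.E}
    (D : IsDrawing (Q.labeledQuad a) M.labeledRotation ε)
    (hF : ∀ h i, Q.tgt (ε h) = Q.x i → M.idx (M.face h) = i) :
    IsOverlay Q M fun h => Q.σ.symm (ε h) := by
  have hσ : ∀ h, Q.σ (Q.σ.symm (ε h)) = ε h := fun h => Q.σ.apply_symm_apply _
  have hr : ∀ c, (c ∈ Set.range fun h => Q.σ.symm (ε h)) ↔ (Q.labeledQuad a).Dec (Q.σ c) :=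
    fun c => by
      rw [D.dec_iff, Set.mem_range]
      simp only [Equiv.symm_apply_eq]
  refine ⟨fun h h' hh => D.inj (Q.σ.symm.injective hh), fun c c' => ?_, fun h => ?_,
    ⟨a, fun h => ?_⟩, fun h e i he hi => ?_⟩
  · constructor
    · rintro ⟨h, rfl, rfl⟩
      rw [← Q.φ_α_σ_apply (Q.σ.symm (ε h)), ← Q.φ_α_σ_apply (Q.σ.symm (ε (M.α h))),
        Q.added_iff a, hσ, hσ]
      exact ⟨D.not_dec h, D.not_dec _, D.swap h⟩
    · intro hc
      obtain ⟨h, rfl⟩ := (hr c).2 ((Q.exists_added_iff a c).1 ⟨c', hc⟩)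
      beta_reduce at hc
      refine ⟨h, rfl, ?_⟩
      rw [← Q.φ_α_σ_apply (Q.σ.symm (ε h)), ← Q.φ_α_σ_apply c', Q.added_iff a, hσ] at hc
      have := (Q.labeledQuad a).partner_unique hc.1 (D.not_dec (M.α h)) hc.2.1 (D.swap h) hc.2.2
      change Q.α (ε (M.α h)) = _ at this
      rw [Equiv.symm_apply_eq]
      exact Q.α.injective this
  · rw [inCorner_iff a hr, hσ]
    obtain ⟨n, hn, hn'⟩ := D.next h
    refine ⟨n, ?_, hn'⟩
    rw [Equiv.eq_symm_apply]
    exact (Function.iterate_succ_apply' _ _ _).symm.trans hn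
  · have h1 := D.lab h
    change M.elabel h = Q.label (Q.src (ε h)) + a at h1
    rw [h1, ← hσ h, Q.src_σ]
    simp [DelayedQuad.elabel]
  · rw [inCorner_iff a hr, hσ] at he
    obtain ⟨n, rfl, hn⟩ := he
    rcases n with _ | n
    · exact hF h i hi
    · have h1 := (Q.exists_eq_x_iff a _).1 ⟨i, rfl⟩ _ hi
      exact absurd (((Q.labeledQuad a).dec_α_iff _).2 (hn n (by omega))) h1

theorem IsOverlay.isDrawn_iff (O : IsOverlay Q M β) (h : M.E) (e : Q.E) :
    IsDrawn Q M β h e ↔ e = Q.σ (β h) := by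
  obtain ⟨a, D⟩ := O.exists_isDrawing
  have hin := inCorner_iff a (O.mem_range_iff a)
  have hx := D.isMin_iff_exists rfl (Q.exists_eq_x_iff a) h
  have hself : InCorner Q M β h (Q.σ (β h)) := (hin _ _).2 ⟨0, rfl, by simp⟩
  unfold IsDrawn
  rcases LabeledRotation.isMin_or_exists_isSucc (M := M.labeledRotation) h with hm | ⟨h', hs⟩
  · rw [M.succ_of_isMin hm]
    constructor
    · rintro ⟨h1, h2⟩
      obtain ⟨n, rfl, hn⟩ := (hin _ _).1 h1
      rcases n with _ | n
      · rfl
      · have h3 := (Q.exists_eq_x_iff a _).1 ⟨_, rfl⟩ _ h2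
        exact absurd (((Q.labeledQuad a).dec_α_iff _).2 (hn n (by omega))) h3
    · rintro rfl
      obtain ⟨i, hi⟩ := hx.1 hm
      exact ⟨hself, (O.faces h _ i hself hi) ▸ hi⟩
  · rw [M.succ_of_isSucc hs]
    constructor
    · rintro ⟨h1, h2⟩
      obtain ⟨n, rfl, hn⟩ := (hin _ _).1 h1
      rcases n with _ | n
      · rfl
      · refine absurd ?_ (hn n (by omega))
        obtain ⟨r, hr, -⟩ := (hin _ _).1 h2
        have h3 : Q.label (Q.tgt (Q.σ^[n + 1] (Q.σ (β h)))) = Q.label (Q.src (Q.σ (β h'))) := by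
          rw [Fatgraph.tgt, ← hr, Q.src_iterate_σ]
        have h4 : M.elabel h = Q.label (Q.src (Q.σ (β h))) + a := D.lab h
        have h5 : M.elabel h' = Q.label (Q.src (Q.σ (β h'))) + a := D.lab h'
        have h6 : M.elabel h' = M.elabel h - 1 := hs.lab_eq
        rw [DelayedQuad.dec_labeledQuad_iff, h3, Q.src_iterate_σ]
        omega
    · rintro rfl
      refine ⟨hself, (hin _ _).2 ?_⟩
      obtain ⟨-, n, hn, hn'⟩ := D.leads_of_isSucc hs
      refine ⟨n + 1, hn, fun j hj => ?_⟩
      rcases Nat.lt_succ_iff_lt_or_eq.1 hj with hj | rfl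
      · exact hn' j hj
      · exact fun hd => D.not_dec h (hn ▸ hd)

end Overlay

/-! ### Existence of overlays -/

section Existence

variable {g k : ℕ} [NeZero k]

theorem DelayedQuad.exists_isOverlay (Q : DelayedQuad g k) :
    ∃ (M : LabeledMap g k) (β : M.E → Q.E), IsOverlay Q M β := by
  obtain ⟨R, D⟩ := (Q.labeledQuad 0).exists_isDrawing
  have hne : Nonempty {e // (Q.labeledQuad 0).Dec e} := by
    obtain ⟨e⟩ := Q.nonempty
    by_cases he : (Q.labeledQuad 0).Dec e
    · exact ⟨⟨e, he⟩⟩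
    · exact ⟨⟨_, ((Q.labeledQuad 0).dec_α_iff e).2 he⟩⟩
  let m := Fatgraph.ofRotation R.toRotationSystem D.α_ne (D.iff_of_connected Q.connected)
  have D' : IsDrawing (H := m.E) (Q.labeledQuad 0) R Subtype.val := D
  obtain ⟨idx, hidx⟩ := IsDrawing.exists_face_equiv (q := Q.toFatgraph) (m := m) D' rfl rfl
    Q.x_injective (Q.exists_eq_x_iff 0)
  have hgenus : m.HasGenus g := (IsDrawing.hasGenus_iff (q := Q.toFatgraph) (m := m) D' rfl rfl
    Q.x_injective (Q.exists_eq_x_iff 0) Q.quad (by rw [Nat.card_congr idx, Nat.card_fin]) g).1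
      Q.genus
  let M : LabeledMap g k :=
    { toFatgraph := m
      genus := hgenus
      idx := idx
      lab := Quotient.lift R.lab fun h h' hs => (R.lab_eq_of_sameCycle hs).symm
      lab_adj := fun e => by
        rw [abs_sub_comm]
        exact R.lab_α e }
  exact ⟨M, _, IsDrawing.isOverlay (Q := Q) (M := M) (a := 0) D' hidx⟩

theorem LabeledMap.exists_isOverlay (M : LabeledMap g k) :
    ∃ (Q : DelayedQuad g k) (β : M.E → Q.E), IsOverlay Q M β := by
  have D := M.labeledRotation.isDrawing_quad M.α_ne
  set R := M.labeledRotation.quad M.α_ne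
  have hne : Nonempty (M.E ⊕ M.E) := ⟨Sum.inl M.nonempty.some⟩
  let q := Fatgraph.ofRotation R.toRotationSystem
    (fun e he => by have := R.lab_α e; rw [he] at this; omega)
    (D.connected_of_connected M.connected)
  have D' : IsDrawing (E := q.E) R M.labeledRotation Sum.inl := D
  let L : q.Vertex → ℤ := Quotient.lift R.lab fun h h' hs => (R.lab_eq_of_sameCycle hs).symm
  have hL : ∀ e, L (q.tgt e) = L (q.src e) + 1 ∨ L (q.tgt e) = L (q.src e) - 1 := R.lab_α
  have hdec : ∀ v e, q.src e = v → (L (q.tgt e) ≠ L v - 1 ↔ ¬ R.Dec e) := by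
    rintro v e rfl
    rfl
  have hex : ∀ i, ∃ h, M.labeledRotation.IsMin h ∧ M.idx (M.face h) = i := fun i => by
    obtain ⟨h, hh⟩ := M.face_surjective (M.idx.symm i)
    obtain ⟨h', hs, hm⟩ := M.labeledRotation.exists_isMin h
    exact ⟨h', hm, by rw [← M.face_eq_iff.2 hs, hh, Equiv.apply_symm_apply]⟩
  choose c hc hci using hex
  let x : Fin k → q.Vertex := fun i => q.tgt (Sum.inl (c i))
  have htgt : ∀ {h h' : M.E}, M.labeledRotation.IsMin h → M.labeledRotation.IsMin h' →
      (q.tgt (Sum.inl h) = q.tgt (Sum.inl h') ↔ M.face h = M.face h') := fun hm hm' =>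
    IsDrawing.tgt_eq_iff (q := q) (m := M.toFatgraph) D' rfl rfl hm hm'
  have inj : Function.Injective x := fun i j hij => by
    rw [← hci i, ← hci j, (htgt (hc i) (hc j)).1 hij]
  have hmin : ∀ h, M.labeledRotation.IsMin h ↔
      ∀ e, q.src e = q.tgt (Sum.inl h) → ¬ R.Dec e := fun h => by
    rw [D.isMin_iff]
    refine forall_congr' fun e => ?_
    exact imp_congr_left (Equiv.Perm.sameCycle_comm.trans (q.src_eq_iff (e := e)
      (e' := R.α (Sum.inl h))).symm)
  have hx : ∀ v, (∃ i, v = x i) ↔ ∀ e, q.src e = v → ¬ R.Dec e := fun v => by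
    constructor
    · rintro ⟨i, rfl⟩
      exact (hmin _).1 (hc i)
    · intro hv
      obtain ⟨e, rfl⟩ := q.src_surjective v
      obtain ⟨h, rfl⟩ := D.exists_of_not_dec (hv e rfl)
      have hm : M.labeledRotation.IsMin h := (hmin h).2 hv
      exact ⟨M.idx (M.face h), (htgt hm (hc _)).2 (M.idx.injective (hci _).symm)⟩
  have hquad : q.IsQuadrangulation :=
    q.isQuadrangulation_iff_φ.2 fun e => ⟨R.φ_four e, R.φ_two_ne e⟩
  have hgenus : q.HasGenus g := (IsDrawing.hasGenus_iff (q := q) (m := M.toFatgraph) D' rfl rfl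
    inj hx hquad (by rw [Nat.card_congr M.idx, Nat.card_fin]) g).2 M.genus
  have hx₁ : ∀ i e, q.src e = x i → L (q.tgt e) ≠ L (x i) - 1 := fun i e he =>
    (hdec _ e he).2 ((hx _).1 ⟨i, rfl⟩ e he)
  have hx₂ : ∀ v, (∀ e, q.src e = v → L (q.tgt e) ≠ L v - 1) → ∃ i, v = x i := fun v hv =>
    (hx v).2 fun e he => (hdec v e he).1 (hv e he)
  let Q : DelayedQuad g k := DelayedQuad.ofLabels q hgenus hquad L hL x inj hx₁
  have hlab : ∀ v, Q.label v = L v :=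
    DelayedQuad.label_ofLabels q hgenus hquad L hL x inj hx₁ hx₂
  have D'' : IsDrawing (Q.labeledQuad 0) M.labeledRotation Sum.inl :=
    D.map (Q' := Q.labeledQuad 0) (Equiv.refl _) (Equiv.refl _) 0 (fun _ => rfl) (fun _ => rfl)
      (fun _ => rfl) (fun _ => rfl) (fun _ => rfl)
      (fun e => congrArg (· + (0 : ℤ)) (hlab (q.src e))) (fun h => (add_zero _).symm)
  refine ⟨Q, _, IsDrawing.isOverlay (Q := Q) (M := M) (a := 0) D'' fun h i hi => ?_⟩
  have hi' : q.tgt (Sum.inl h) = q.tgt (Sum.inl (c i)) := hi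
  have hm : M.labeledRotation.IsMin h := (hmin h).2 (hi'.symm ▸ (hmin _).1 (hc i))
  rw [(htgt hm (hc i)).1 hi', hci]

end Existence

/-! ### Uniqueness and transport of overlays -/

section Transport

variable {g k : ℕ}

theorem Fatgraph.Iso.map_iterate_φ {m m' : Fatgraph} (f : Fatgraph.Iso m m') (n : ℕ) (e : m.E) :
    f.toEquiv (m.φ^[n] e) = m'.φ^[n] (f.toEquiv e) := by
  induction n with
  | zero => rfl
  | succ n ih => rw [Function.iterate_succ_apply', f.map_φ, ih, Function.iterate_succ_apply']

theorem Fatgraph.Iso.map_iterate_σ {m m' : Fatgraph} (f : Fatgraph.Iso m m') (n : ℕ) (e : m.E) :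
    f.toEquiv (m.σ^[n] e) = m'.σ^[n] (f.toEquiv e) := by
  induction n with
  | zero => rfl
  | succ n ih => rw [Function.iterate_succ_apply', f.map_σ, ih, Function.iterate_succ_apply']

theorem Fatgraph.Iso.face_eq {m m' : Fatgraph} (f : Fatgraph.Iso m m') {e e' : m.E}
    (h : m.face e = m.face e') : m'.face (f.toEquiv e) = m'.face (f.toEquiv e') := by
  obtain ⟨n, rfl⟩ := (m.face_eq_iff.1 h).exists_iterate_eq
  rw [f.map_iterate_φ]
  exact m'.face_eq_iff.2 (Equiv.Perm.sameCycle_iterate _ _ _)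

theorem Fatgraph.Iso.src_eq {m m' : Fatgraph} (f : Fatgraph.Iso m m') {e e' : m.E}
    (h : m.src e = m.src e') : m'.src (f.toEquiv e) = m'.src (f.toEquiv e') := by
  obtain ⟨n, rfl⟩ := (m.src_eq_iff.1 h).exists_iterate_eq
  rw [f.map_iterate_σ, m'.src_iterate_σ]

theorem Fatgraph.Iso.dist_le {m m' : Fatgraph} (f : Fatgraph.Iso m m') (e e₀ : m.E) :
    m'.dist (m'.src (f.toEquiv e)) (m'.src (f.toEquiv e₀)) ≤ m.dist (m.src e) (m.src e₀) := by
  refine m.dist_induction (w := m.src e₀) (P := fun v n => ∀ e, m.src e = v →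
    m'.dist (m'.src (f.toEquiv e)) (m'.src (f.toEquiv e₀)) ≤ n) ?_ ?_ (m.src e) e rfl
  · intro e he
    rw [f.src_eq he, m'.dist_self]
  · intro e₁ n ih e he
    have h1 := m'.dist_src_le (f.toEquiv e₁) (m'.src (f.toEquiv e₀))
    have h2 := ih (m.α e₁) rfl
    rw [f.map_α] at h2
    rw [f.src_eq he]
    change m'.dist (m'.tgt (f.toEquiv e₁)) _ ≤ n at h2
    omega

theorem DelayedQuad.elabel_iso [NeZero k] {Q Q' : DelayedQuad g k}
    (f : Fatgraph.Iso Q.toFatgraph Q'.toFatgraph)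
    (hx : ∀ e i, Q.src e = Q.x i ↔ Q'.src (f.toEquiv e) = Q'.x i) {c : ℤ}
    (hd : ∀ i, Q'.d i = Q.d i + c) (e : Q.E) : Q'.elabel (f.toEquiv e) = Q.elabel e + c := by
  have key : ∀ {Q Q' : DelayedQuad g k} (f : Fatgraph.Iso Q.toFatgraph Q'.toFatgraph),
      (∀ e i, Q.src e = Q.x i ↔ Q'.src (f.toEquiv e) = Q'.x i) → ∀ {c : ℤ},
      (∀ i, Q'.d i = Q.d i + c) → ∀ e, Q'.elabel (f.toEquiv e) ≤ Q.elabel e + c := by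
    intro Q Q' f hx c hd e
    obtain ⟨i, hi⟩ := Q.exists_label_eq (Q.src e)
    obtain ⟨e₀, he₀⟩ := Q.src_surjective (Q.x i)
    have h1 := Q'.label_le (Q'.src (f.toEquiv e)) i
    have h2 := f.dist_le e e₀
    rw [(hx e₀ i).1 he₀, he₀] at h2
    have h3 := hd i
    unfold elabel
    omega
  refine le_antisymm (key f hx hd e) ?_
  have h1 := key f.symm (fun e i => by rw [hx]; simp [Fatgraph.Iso.symm]) (c := -c)
    (fun i => by rw [hd]; ring) (f.toEquiv e)
  have h2 : f.symm.toEquiv (f.toEquiv e) = e := f.toEquiv.symm_apply_apply e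
  rw [h2] at h1
  omega

variable [NeZero k]

theorem IsOverlay.tgt_eq_x_iff {Q : DelayedQuad g k} {M : LabeledMap g k} {β : M.E → Q.E}
    (O : IsOverlay Q M β) (h : M.E) (i : Fin k) :
    Q.tgt (Q.σ (β h)) = Q.x i ↔ M.labeledRotation.IsMin h ∧ M.idx (M.face h) = i := by
  obtain ⟨a, D⟩ := O.exists_isDrawing
  have hx := D.isMin_iff_exists rfl (Q.exists_eq_x_iff a) h
  have hin : InCorner Q M β h (Q.σ (β h)) := ⟨1, le_rfl, rfl, by omega⟩
  constructor
  · intro hi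
    exact ⟨hx.2 ⟨i, hi⟩, O.faces h _ i hin hi⟩
  · rintro ⟨hm, rfl⟩
    obtain ⟨i, hi⟩ := hx.1 hm
    rw [O.faces h _ i hin hi]
    exact hi

/-- The labeled map of a quadrangulation with delays is unique. -/
theorem IsOverlay.exists_iso_map {Q : DelayedQuad g k} {M M' : LabeledMap g k} {β : M.E → Q.E}
    {β' : M'.E → Q.E} (O : IsOverlay Q M β) (O' : IsOverlay Q M' β') :
    ∃ f : Fatgraph.Iso M.toFatgraph M'.toFatgraph, (∀ h, β' (f.toEquiv h) = β h) ∧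
      (∀ h, M'.idx (M'.face (f.toEquiv h)) = M.idx (M.face h)) ∧
      ∃ c : ℤ, ∀ h, M'.lab (M'.src (f.toEquiv h)) = M.lab (M.src h) + c := by
  obtain ⟨a, D⟩ := O.exists_isDrawing
  obtain ⟨a', D'⟩ := O'.exists_isDrawing
  let R : LabeledRotation M'.E :=
    { M'.labeledRotation with
      lab := fun h => M'.elabel h + (a - a')
      lab_σ := fun h => congrArg (· + (a - a')) (M'.labeledRotation.lab_σ h)
      lab_α := fun h => by
        rw [add_sub_add_right_eq_sub]
        exact M'.labeledRotation.lab_α h }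
  have D'' : IsDrawing (Q.labeledQuad a) R fun h => Q.σ (β' h) :=
    D'.map (Q' := Q.labeledQuad a) (M' := R) (Equiv.refl _) (Equiv.refl _) (a - a') (fun _ => rfl)
      (fun _ => rfl) (fun _ => rfl) (fun _ => rfl) (fun _ => rfl)
      (fun e => by
        change Q.elabel e + a = Q.elabel e + a' + (a - a')
        ring) (fun _ => rfl)
  obtain ⟨G, hG, hGσ, hGα, hGφ⟩ := D.exists_equiv_map D''
  let f : Fatgraph.Iso M.toFatgraph M'.toFatgraph := ⟨G, hGσ, hGα, hGφ⟩
  have hf : ∀ h, β' (f.toEquiv h) = β h := fun h => Q.σ.injective (hG h)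
  refine ⟨f, hf, fun h => ?_, a' - a, fun h => ?_⟩
  · obtain ⟨h₀, hs, hm⟩ := M.labeledRotation.exists_isMin h
    have hface : M.face h = M.face h₀ := M.face_eq_iff.2 hs
    rw [f.face_eq hface, hface]
    have h1 := (O.tgt_eq_x_iff h₀ _).2 ⟨hm, rfl⟩
    rw [← hf] at h1
    exact ((O'.tgt_eq_x_iff _ _).1 h1).2
  · have h1 : M.elabel h = Q.elabel (Q.σ (β h)) + a := D.lab h
    have h2 : M'.elabel (f.toEquiv h) = Q.elabel (Q.σ (β' (f.toEquiv h))) + a' := D'.lab _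
    rw [hf] at h2
    change M'.elabel (f.toEquiv h) = M.elabel h + (a' - a)
    omega

/-- The quadrangulation with delays of a labeled map is unique. -/
theorem IsOverlay.exists_iso_quad {Q Q' : DelayedQuad g k} {M : LabeledMap g k} {β : M.E → Q.E}
    {β' : M.E → Q'.E} (O : IsOverlay Q M β) (O' : IsOverlay Q' M β') :
    ∃ f : Fatgraph.Iso Q.toFatgraph Q'.toFatgraph,
      (∀ h, f.toEquiv (Q.σ (β h)) = Q'.σ (β' h)) ∧
      (∀ e i, Q.src e = Q.x i ↔ Q'.src (f.toEquiv e) = Q'.x i) ∧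
      ∃ c : ℤ, ∀ i, Q'.d i = Q.d i + c := by
  obtain ⟨a, D⟩ := O.exists_isDrawing
  obtain ⟨a', D'⟩ := O'.exists_isDrawing
  obtain ⟨F, hF, hFσ, hFα, hFφ⟩ := D.exists_equiv_quad D'
  let f : Fatgraph.Iso Q.toFatgraph Q'.toFatgraph := ⟨F, hFσ, hFα, hFφ⟩
  refine ⟨f, hF, fun e i => ?_, a - a', fun i => ?_⟩
  · by_cases he : (Q.labeledQuad a).Dec e
    · obtain ⟨h, rfl⟩ := (D.dec_iff e).1 he
      refine iff_of_false (fun hs => ?_) (fun hs => ?_)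
      · exact (Q.exists_eq_x_iff a _).1 ⟨i, rfl⟩ _ hs (D.dec h)
      · refine (Q'.exists_eq_x_iff a' _).1 ⟨i, rfl⟩ _ hs ?_
        exact (hF h).symm ▸ D'.dec h
    · obtain ⟨h, rfl⟩ := D.exists_of_not_dec he
      have h1 : f.toEquiv ((Q.labeledQuad a).α (Q.σ (β h))) = Q'.α (Q'.σ (β' h)) :=
        (hFα _).trans (congrArg Q'.α (hF h))
      rw [h1]
      exact (O.tgt_eq_x_iff h i).trans (O'.tgt_eq_x_iff h i).symm
  · obtain ⟨h, hh⟩ := M.face_surjective (M.idx.symm i)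
    obtain ⟨h₀, hs, hm⟩ := M.labeledRotation.exists_isMin h
    have hi : M.idx (M.face h₀) = i := by
      rw [← M.face_eq_iff.2 hs, hh, Equiv.apply_symm_apply]
    have h1 := (O.tgt_eq_x_iff h₀ i).2 ⟨hm, hi⟩
    have h2 := (O'.tgt_eq_x_iff h₀ i).2 ⟨hm, hi⟩
    have h3 : M.elabel h₀ = Q.label (Q.src (Q.σ (β h₀))) + a := D.lab h₀
    have h4 : M.elabel h₀ = Q'.label (Q'.src (Q'.σ (β' h₀))) + a' := D'.lab h₀
    have h5 := (Q.dec_labeledQuad_iff a _).1 (D.dec h₀)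
    have h6 := (Q'.dec_labeledQuad_iff a' _).1 (D'.dec h₀)
    rw [h1, Q.label_x] at h5
    rw [h2, Q'.label_x] at h6
    omega

theorem IsOverlay.map_quad {Q Q' : DelayedQuad g k} {M : LabeledMap g k} {β : M.E → Q.E}
    (O : IsOverlay Q M β) (f : Fatgraph.Iso Q.toFatgraph Q'.toFatgraph)
    (hx : ∀ e i, Q.src e = Q.x i ↔ Q'.src (f.toEquiv e) = Q'.x i) {c : ℤ}
    (hd : ∀ i, Q'.d i = Q.d i + c) : IsOverlay Q' M fun h => f.toEquiv (β h) := by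
  obtain ⟨a, D⟩ := O.exists_isDrawing
  have D' : IsDrawing (Q'.labeledQuad (a - c)) M.labeledRotation
      fun h => f.toEquiv (Q.σ (β h)) :=
    D.map f.toEquiv (Equiv.refl _) 0 f.map_σ f.map_α f.map_φ (fun _ => rfl) (fun _ => rfl)
      (fun e => by
        change Q'.elabel (f.toEquiv e) + (a - c) = Q.elabel e + a + 0
        rw [DelayedQuad.elabel_iso f hx hd]
        ring) (fun _ => (add_zero _).symm)
  have h1 := IsDrawing.isOverlay D' fun h i hi => by
    refine ((O.tgt_eq_x_iff h i).1 ((hx _ i).2 ?_)).2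
    rw [f.map_α]
    exact hi
  have h2 : (fun h => Q'.σ.symm (f.toEquiv (Q.σ (β h)))) = fun h => f.toEquiv (β h) :=
    funext fun h => by rw [Equiv.symm_apply_eq, f.map_σ]
  rwa [h2] at h1

theorem IsOverlay.map_map {Q : DelayedQuad g k} {M M' : LabeledMap g k} {β : M.E → Q.E}
    (O : IsOverlay Q M β) (f : Fatgraph.Iso M'.toFatgraph M.toFatgraph)
    (hidx : ∀ h, M.idx (M.face (f.toEquiv h)) = M'.idx (M'.face h)) {c : ℤ}
    (hlab : ∀ h, M.lab (M.src (f.toEquiv h)) = M'.lab (M'.src h) + c) :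
    IsOverlay Q M' fun h => β (f.toEquiv h) := by
  obtain ⟨a, D⟩ := O.exists_isDrawing
  have D' : IsDrawing (Q.labeledQuad (a - c)) M'.labeledRotation
      fun h => Q.σ (β (f.toEquiv h)) :=
    D.map (Q' := Q.labeledQuad (a - c)) (Equiv.refl _) f.toEquiv (-c) (fun _ => rfl)
      (fun _ => rfl) (fun _ => rfl) f.map_σ f.map_α
      (fun e => by
        change Q.elabel e + (a - c) = Q.elabel e + a + -c
        ring)
      (fun h => by
        change M'.lab (M'.src h) = M.lab (M.src (f.toEquiv h)) + -c
        rw [hlab]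
        ring)
  have h1 := IsDrawing.isOverlay D' fun h i hi => by
    rw [← hidx]
    exact ((O.tgt_eq_x_iff _ i).1 hi).2
  simpa using h1

end Transport

/-! ### The correspondence on rooted objects -/

section Rooted

variable {g k : ℕ} [NeZero k]

theorem isPsiRep_iff {Q : RootedDelayedQuad g k} {M : RootedLabeledMap g k} :
    IsPsiRep Q M ↔ ∃ β : M.E → Q.E, IsOverlay Q.toDelayedQuad M.toLabeledMap β ∧
      (Q.root = Q.σ (β M.root) ∨ Q.root = Q.α (Q.σ (β M.root))) := by
  refine exists_congr fun β => and_congr_right fun O => ?_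
  rw [O.isDrawn_iff, O.isDrawn_iff]
  refine or_congr_right ⟨fun h => ?_, fun h => ?_⟩
  · rw [← h, Q.α_invol]
  · rw [h, Q.α_invol]

theorem exists_isPsiRep (Q : RootedDelayedQuad g k) : ∃ M : RootedLabeledMap g k, IsPsiRep Q M := by
  obtain ⟨M, β, O⟩ := Q.toDelayedQuad.exists_isOverlay
  obtain ⟨a, D⟩ := O.exists_isDrawing
  by_cases he : (Q.labeledQuad a).Dec Q.root
  · obtain ⟨h, hh⟩ := (D.dec_iff _).1 he
    exact ⟨⟨M, h⟩, isPsiRep_iff.2 ⟨β, O, Or.inl hh.symm⟩⟩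
  · obtain ⟨h, hh⟩ := D.exists_of_not_dec he
    exact ⟨⟨M, h⟩, isPsiRep_iff.2 ⟨β, O, Or.inr hh.symm⟩⟩

theorem IsPsiRep.of_equivalent_left {Q Q' : RootedDelayedQuad g k} {M : RootedLabeledMap g k}
    (h : IsPsiRep Q M) (hQ : Q.Equivalent Q') : IsPsiRep Q' M := by
  obtain ⟨β, O, hr⟩ := isPsiRep_iff.1 h
  obtain ⟨f, hf, hx, c, hd⟩ := hQ
  refine isPsiRep_iff.2 ⟨_, O.map_quad f hx hd, ?_⟩
  rw [← f.map_σ, ← f.map_α, ← hf]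
  exact hr.imp (congrArg _) (congrArg _)

theorem IsPsiRep.of_equivalent_right {Q : RootedDelayedQuad g k} {M M' : RootedLabeledMap g k}
    (h : IsPsiRep Q M) (hM : M'.Equivalent M) : IsPsiRep Q M' := by
  obtain ⟨β, O, hr⟩ := isPsiRep_iff.1 h
  obtain ⟨f, hf, hidx, c, hlab⟩ := hM
  refine isPsiRep_iff.2 ⟨_, O.map_map f hidx hlab, ?_⟩
  rw [hf]
  exact hr

theorem IsPsiRep.unique {Q : RootedDelayedQuad g k} {M M' : RootedLabeledMap g k}
    (h : IsPsiRep Q M) (h' : IsPsiRep Q M') : M.Equivalent M' := by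
  obtain ⟨β, O, hr⟩ := isPsiRep_iff.1 h
  obtain ⟨β', O', hr'⟩ := isPsiRep_iff.1 h'
  obtain ⟨f, hf, hidx, hlab⟩ := O.exists_iso_map O'
  refine ⟨f, O'.inj ?_, hidx, hlab⟩
  rw [hf]
  have hd := (O.mem_range_iff 0 _).1 ⟨M.root, rfl⟩
  have hd' := (O'.mem_range_iff 0 _).1 ⟨M'.root, rfl⟩
  have hα := fun e => (Q.labeledQuad 0).dec_α_iff e
  change ∀ e, (Q.labeledQuad 0).Dec (Q.α e) ↔ _ at hα
  apply Q.σ.injective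
  rcases hr with hr | hr <;> rcases hr' with hr' | hr'
  · rw [← hr, ← hr']
  · rw [← hr, hr', hα] at hd
    exact absurd hd' hd
  · rw [← hr', hr, hα] at hd'
    exact absurd hd hd'
  · exact Q.α.injective (hr.symm.trans hr')

theorem existsUnique_isPsi (Q : QClass g k) : ∃! M : LMClass g k, IsPsi Q M := by
  obtain ⟨q, rfl⟩ := Quotient.exists_rep Q
  obtain ⟨m, hm⟩ := exists_isPsiRep q
  refine ⟨Quotient.mk _ m, ⟨q, m, rfl, rfl, hm⟩, ?_⟩
  rintro _ ⟨q', m', hq, rfl, hm'⟩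
  have hq' : q'.Equivalent q := Quotient.exact hq
  exact Quotient.sound ((hm'.of_equivalent_left hq').unique hm)

/-- Two roots are possible for the quadrangulation of a rooted labeled map. -/
theorem exists_preimages (M : LMClass g k) :
    ∃ Q₁ Q₂ : QClass g k, Q₁ ≠ Q₂ ∧ ∀ Q, IsPsi Q M ↔ Q = Q₁ ∨ Q = Q₂ := by
  obtain ⟨m, rfl⟩ := Quotient.exists_rep M
  obtain ⟨Q, β, O⟩ := m.toLabeledMap.exists_isOverlay
  let r : Q.E := Q.σ (β m.root)
  let q₁ : RootedDelayedQuad g k := ⟨Q, r⟩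
  let q₂ : RootedDelayedQuad g k := ⟨Q, Q.α r⟩
  have h₁ : IsPsiRep q₁ m := isPsiRep_iff.2 ⟨β, O, Or.inl rfl⟩
  have h₂ : IsPsiRep q₂ m := isPsiRep_iff.2 ⟨β, O, Or.inr rfl⟩
  refine ⟨Quotient.mk _ q₁, Quotient.mk _ q₂, fun heq => ?_, fun Q' => ⟨?_, ?_⟩⟩
  · obtain ⟨f, hf, hx, c, hd⟩ : q₁.Equivalent q₂ := Quotient.exact heq
    have hc : c = 0 := by
      have h3 : Q.d 0 = Q.d 0 + c := hd 0
      omega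
    have h4 : Q.elabel (f.toEquiv r) = Q.elabel r + c :=
      DelayedQuad.elabel_iso (Q := Q) (Q' := Q) f hx hd r
    have h5 : f.toEquiv r = Q.α r := hf
    have h6 := (Q.dec_labeledQuad_iff 0 r).1 ((O.mem_range_iff 0 _).1 ⟨m.root, rfl⟩)
    rw [h5] at h4
    change Q.label (Q.tgt r) = Q.label (Q.src r) + c at h4
    omega
  · rintro ⟨q, m', rfl, hm, hq⟩
    have hq' : IsPsiRep q m := hq.of_equivalent_right (Quotient.exact hm.symm)
    obtain ⟨β', O', hr⟩ := isPsiRep_iff.1 hq'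
    obtain ⟨f, hf, hx, hd⟩ := O.exists_iso_quad O'
    rcases hr with hr | hr
    · exact Or.inl (Quotient.sound (RootedDelayedQuad.setoid g k |>.symm
        ⟨f, (hf m.root).trans hr.symm, hx, hd⟩))
    · refine Or.inr (Quotient.sound (RootedDelayedQuad.setoid g k |>.symm ⟨f, ?_, hx, hd⟩))
      exact ((f.map_α r).trans (congrArg q.α (hf m.root))).trans hr.symm
  · rintro (rfl | rfl)
    · exact ⟨q₁, m, rfl, rfl, h₁⟩
    · exact ⟨q₂, m, rfl, rfl, h₂⟩

end Rooted

theorem mainTheorem6 (g k : ℕ) (hk : 1 ≤ k) :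
    ∃ Ψ : QClass g k → LMClass g k,
      (∀ Q M, IsPsi Q M ↔ Ψ Q = M) ∧
      ∀ M : LMClass g k, (Ψ ⁻¹' {M}).ncard = 2 := by
  have : NeZero k := ⟨by omega⟩
  choose Ψ hΨ hunique using fun Q : QClass g k => existsUnique_isPsi Q
  have hiff : ∀ Q M, IsPsi Q M ↔ Ψ Q = M := fun Q M =>
    ⟨fun h => (hunique Q M h).symm, fun h => h ▸ hΨ Q⟩
  refine ⟨Ψ, hiff, fun M => ?_⟩
  obtain ⟨Q₁, Q₂, hne, hQ⟩ := exists_preimages M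
  have : Ψ ⁻¹' {M} = {Q₁, Q₂} := by
    ext Q
    rw [Set.mem_preimage, Set.mem_singleton_iff, ← hiff, hQ]
    rfl
  rw [this, Set.ncard_pair hne]
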